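/- Let $\mathbb T$ be the unit circle with normalized Haar measure. For a complex Banach space $Y$ let $\widetilde H^1(Y)$ be the closure in $L^1(\mathbb T;Y)$ of the $Y$-valued analytic polynomials $\sum_{k=0}^n e^{ik\theta}y_k$ ($y_k\in Y$); write $L^1=L^1(\mathbb T;\mathbb C)$ and $H^1=\widetilde H^1(\mathbb C)\subset L^1$. Let $H^1\hat\otimes Y$ be the projective tensor product (the completion of $H^1\otimes Y$ in the projective norm $\|u\|_\wedge=\inf\{\sum_k\|h_k\|\,\|y_k\| : u=\sum_k h_k\otimes y_k\}$), and let $I_Y:H^1\hat\otimes Y\to\widetilde H^1(Y)$ be the canonical norm-decreasing map with $I_Y(h\otimes y)=h(\cdot)\,y$. The space $Y$ is called $H^1$-projective if $I_Y$ is surjective; in that case $\eta(Y)$ denotes the smallest constant $c\ge 0$ such that $\|F\|_{H^1\hat\otimes Y}\le c\,\|I_Y F\|_{\widetilde H^1(Y)}$ for all $F\in H^1\hat\otimes Y$. For a complex Banach space $X$, let $\mathcal L_F(L^1,X)$ be the set of bounded operators $u:L^1\to X$ for which there is a positive integer $k$ with $u(e^{in\theta})=0$ for all integers $n\notin[-k,k]$,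 and let $\mathcal L_F(H^1,X)$ be the set of bounded operators $v:H^1\to X$ for which there is a positive integer $k$ with $v(e^{in\theta})=0$ for all integers $n>k$. **Proposition 2.5.** Let $X$ be a complex Banach space with dual $X^*$. The following are equivalent: (i) $X^*$ is $H^1$-projective. (ii) There is a constant $\lambda\ge 0$ such that every $v\in\mathcal L_F(H^1,X)$ has an extension $\bar v\in\mathcal L_F(L^1,X)$ (that is, $\bar v|_{H^1}=v$) with $\|\bar v\|\le\lambda\|v\|$. Moreover, if these hold, the infimum of the constants $\lambda\ge 0$ that satisfy (ii) is equal to $\eta(X^*)$. -/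

import Mathlib

open MeasureTheory TensorProduct
open scoped ENNReal

noncomputable section

namespace HOne

/-! ### The projective tensor product of two normed spaces -/

section Projective

variable (E F : Type*) [NormedAddCommGroup E] [NormedSpace ℂ E]
  [NormedAddCommGroup F] [NormedSpace ℂ F]

/-- The algebraic tensor product `E ⊗ F`, as a type that carries the projective norm. -/
def AlgTensor : Type _ := E ⊗[ℂ] F

instance : AddCommGroup (AlgTensor E F) := inferInstanceAs (AddCommGroup (E ⊗[ℂ] F))
instance : Module ℂ (AlgTensor E F) := inferInstanceAs (Module ℂ (E ⊗[ℂ] F))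

variable {E F}

/-- The elementary tensor `x ⊗ y`. -/
def AlgTensor.mk (x : E) (y : F) : AlgTensor E F := x ⊗ₜ[ℂ] y

/-- All the numbers `∑ ‖xᵢ‖ ‖yᵢ‖`, over the finite representations `u = ∑ xᵢ ⊗ yᵢ`. -/
def repSums (u : AlgTensor E F) : Set ℝ :=
  {r | ∃ (n : ℕ) (x : Fin n → E) (y : Fin n → F),
    u = ∑ i, AlgTensor.mk (x i) (y i) ∧ r = ∑ i, ‖x i‖ * ‖y i‖}

/-- The projective norm. -/
def projNorm (u : AlgTensor E F) : ℝ := sInf (repSums u)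

lemma repSums_bddBelow (u : AlgTensor E F) : BddBelow (repSums u) := by
  refine ⟨0, ?_⟩
  rintro r ⟨n, x, y, -, rfl⟩
  positivity

lemma add_mem_repSums {u v : AlgTensor E F} {r s : ℝ} (hr : r ∈ repSums u)
    (hs : s ∈ repSums v) : r + s ∈ repSums (u + v) := by
  obtain ⟨n, x, y, rfl, rfl⟩ := hr
  obtain ⟨m, x', y', rfl, rfl⟩ := hs
  refine ⟨n + m, Fin.append x x', Fin.append y y', ?_, ?_⟩ <;> simp [Fin.sum_univ_add]

lemma smul_mem_repSums (a : ℂ) {u : AlgTensor E F} {r : ℝ} (hr : r ∈ repSums u) :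
    ‖a‖ * r ∈ repSums (a • u) := by
  obtain ⟨n, x, y, rfl, rfl⟩ := hr
  refine ⟨n, fun i => a • x i, y, ?_, ?_⟩
  · rw [Finset.smul_sum]
    exact Finset.sum_congr rfl fun i _ => (TensorProduct.smul_tmul' a (x i) (y i))
  · simp [norm_smul, Finset.mul_sum, mul_assoc]

lemma mk_mem_repSums (x : E) (y : F) : ‖x‖ * ‖y‖ ∈ repSums (AlgTensor.mk x y) :=
  ⟨1, fun _ => x, fun _ => y, by simp, by simp⟩

lemma zero_mem_repSums : (0 : ℝ) ∈ repSums (0 : AlgTensor E F) :=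
  ⟨0, Fin.elim0, Fin.elim0, by simp, by simp⟩

lemma repSums_nonempty (u : AlgTensor E F) : (repSums u).Nonempty := by
  induction u using TensorProduct.induction_on with
  | zero => exact ⟨0, zero_mem_repSums⟩
  | tmul x y => exact ⟨_, mk_mem_repSums x y⟩
  | add u v hu hv =>
    obtain ⟨r, hr⟩ := hu
    obtain ⟨s, hs⟩ := hv
    exact ⟨_, add_mem_repSums hr hs⟩

lemma projNorm_nonneg (u : AlgTensor E F) : 0 ≤ projNorm u := by
  refine Real.sInf_nonneg ?_
  rintro r ⟨n, x, y, -, rfl⟩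
  positivity

lemma projNorm_zero : projNorm (0 : AlgTensor E F) = 0 :=
  le_antisymm (csInf_le (repSums_bddBelow _) zero_mem_repSums) (projNorm_nonneg _)

lemma projNorm_add_le (u v : AlgTensor E F) : projNorm (u + v) ≤ projNorm u + projNorm v := by
  refine le_of_forall_pos_lt_add fun ε hε => ?_
  obtain ⟨r, hr, hr'⟩ := exists_lt_of_csInf_lt (repSums_nonempty u)
    (lt_add_of_pos_right (sInf (repSums u)) (half_pos hε))
  obtain ⟨s, hs, hs'⟩ := exists_lt_of_csInf_lt (repSums_nonempty v)
    (lt_add_of_pos_right (sInf (repSums v)) (half_pos hε))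
  have h := csInf_le (repSums_bddBelow _) (add_mem_repSums hr hs)
  simp only [projNorm]
  linarith

lemma projNorm_smul_le (a : ℂ) (u : AlgTensor E F) : projNorm (a • u) ≤ ‖a‖ * projNorm u := by
  rcases eq_or_ne a 0 with rfl | ha
  · simp [projNorm_zero]
  · have ha' : 0 < ‖a‖ := norm_pos_iff.mpr ha
    rw [← div_le_iff₀' ha']
    refine le_csInf (repSums_nonempty u) fun r hr => ?_
    rw [div_le_iff₀' ha']
    exact csInf_le (repSums_bddBelow _) (smul_mem_repSums a hr)

variable (E F) in
/-- The projective norm as a seminorm (its definiteness is not needed to form the completion). -/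
def projSeminorm : Seminorm ℂ (AlgTensor E F) :=
  Seminorm.ofSMulLE projNorm projNorm_zero projNorm_add_le projNorm_smul_le

instance : SeminormedAddCommGroup (AlgTensor E F) :=
  (projSeminorm E F).toAddGroupSeminorm.toSeminormedAddCommGroup

instance : NormedSpace ℂ (AlgTensor E F) := ⟨projNorm_smul_le⟩

lemma norm_algTensor_def (u : AlgTensor E F) : ‖u‖ = projNorm u := rfl

variable (E F) in
/-- The projective tensor product: the completion of `E ⊗ F` in the projective norm. -/
abbrev ProjTensor : Type _ := UniformSpace.Completion (AlgTensor E F)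

/-- A bilinear map `B` with `‖B x y‖ ≤ ‖x‖ ‖y‖` gives a linear contraction of `E ⊗ F`. -/
def liftAlg {G : Type*} [NormedAddCommGroup G] [NormedSpace ℂ G] (B : E →ₗ[ℂ] F →ₗ[ℂ] G)
    (hB : ∀ x y, ‖B x y‖ ≤ ‖x‖ * ‖y‖) : AlgTensor E F →L[ℂ] G :=
  LinearMap.mkContinuous (TensorProduct.lift B : E ⊗[ℂ] F →ₗ[ℂ] G) 1 <| by
    intro u
    rw [one_mul]
    refine le_csInf (repSums_nonempty u) ?_
    rintro r ⟨n, x, y, rfl, rfl⟩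
    have h : (TensorProduct.lift B : E ⊗[ℂ] F →ₗ[ℂ] G) (∑ i, AlgTensor.mk (x i) (y i))
        = ∑ i, B (x i) (y i) := by
      refine (map_sum (TensorProduct.lift B : E ⊗[ℂ] F →ₗ[ℂ] G) _ _).trans ?_
      exact Finset.sum_congr rfl fun i _ => TensorProduct.lift.tmul (x i) (y i)
    refine (congrArg norm h).trans_le ?_
    exact (norm_sum_le _ _).trans (Finset.sum_le_sum fun i _ => hB _ _)

lemma liftAlg_mk {G : Type*} [NormedAddCommGroup G] [NormedSpace ℂ G] (B : E →ₗ[ℂ] F →ₗ[ℂ] G)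
    (hB : ∀ x y, ‖B x y‖ ≤ ‖x‖ * ‖y‖) (x : E) (y : F) :
    liftAlg B hB (AlgTensor.mk x y) = B x y :=
  TensorProduct.lift.tmul x y

end Projective

/-! ### `L¹` of the circle and Hardy spaces -/

/-- `L¹(𝕋; X)`, for the normalized Haar measure of the circle `𝕋 = ℝ/ℤ`; the character
`e^{inθ}` is `fourier n`. -/
abbrev LOne (X : Type*) [NormedAddCommGroup X] : Type _ :=
  Lp X 1 (AddCircle.haarAddCircle : Measure UnitAddCircle)

/-- The scalar function `e^{inθ}` as an element of `L¹`. -/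
def expo (n : ℤ) : LOne ℂ := fourierLp 1 n

section Hardy

variable {X : Type*} [NormedAddCommGroup X] [NormedSpace ℂ X]

/-- The function `t ↦ f(t) x`. -/
def tensorFun (f : LOne ℂ) (x : X) : LOne X :=
  (ContinuousLinearMap.toSpanSingleton ℂ x).compLp f

lemma coeFn_tensorFun (f : LOne ℂ) (x : X) :
    tensorFun f x =ᵐ[AddCircle.haarAddCircle] fun t => f t • x := by
  filter_upwards [(ContinuousLinearMap.toSpanSingleton ℂ x).coeFn_compLp f] with t ht
  exact ht

lemma norm_tensorFun_le (f : LOne ℂ) (x : X) : ‖tensorFun f x‖ ≤ ‖f‖ * ‖x‖ := by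
  refine (ContinuousLinearMap.norm_compLp_le _ f).trans ?_
  rw [ContinuousLinearMap.norm_toSpanSingleton, mul_comm]

variable (X) in
/-- `(f, x) ↦ f x` as a bilinear map. -/
def tensorFunₗ : LOne ℂ →ₗ[ℂ] X →ₗ[ℂ] LOne X :=
  LinearMap.mk₂ ℂ tensorFun
    (fun f g x => ((ContinuousLinearMap.toSpanSingleton ℂ x).compLpₗ 1 _).map_add f g)
    (fun c f x => ((ContinuousLinearMap.toSpanSingleton ℂ x).compLpₗ 1 _).map_smul c f)
    (fun f x y => by
      simp only [tensorFun, ContinuousLinearMap.toSpanSingleton_add,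
        ContinuousLinearMap.add_compLp])
    (fun c f x => by
      simp only [tensorFun, ContinuousLinearMap.toSpanSingleton_smul,
        ContinuousLinearMap.smul_compLp])

lemma tensorFunₗ_apply (f : LOne ℂ) (x : X) : tensorFunₗ X f x = tensorFun f x := rfl

variable (X) in
/-- The `X`-valued analytic polynomials `∑ e^{ikθ} xₖ`, `k ≥ 0`. -/
def analyticPolys : Submodule ℂ (LOne X) :=
  Submodule.span ℂ {f | ∃ (n : ℕ) (x : X), f = tensorFun (expo n) x}

variable (X) in
/-- The Hardy space `H̃¹(X)`: the closure in `L¹(𝕋; X)` of the analytic polynomials. For `X = ℂ`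
this is `H¹`, as a subspace of `L¹`. -/
abbrev HardyOne : Submodule ℂ (LOne X) := (analyticPolys X).topologicalClosure

lemma tensorFun_expo_mem (n : ℕ) (x : X) : tensorFun (expo n) x ∈ HardyOne X :=
  Submodule.le_topologicalClosure _ (Submodule.subset_span ⟨n, x, rfl⟩)

lemma tensorFun_one (f : LOne ℂ) : tensorFun f (1 : ℂ) = f := by
  refine Lp.ext ?_
  filter_upwards [coeFn_tensorFun f (1 : ℂ)] with t ht
  simp [ht]

lemma expo_mem (n : ℕ) : expo n ∈ HardyOne ℂ := by
  simpa [tensorFun_one] using tensorFun_expo_mem n (1 : ℂ)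

/-- `e^{inθ}`, `n ≥ 0`, as an element of `H¹`. -/
def expoH (n : ℕ) : HardyOne ℂ := ⟨expo n, expo_mem n⟩

lemma tensorFun_tensorFun (f : LOne ℂ) (a : ℂ) (x : X) :
    tensorFun (tensorFun f a) x = tensorFun f (a • x) := by
  refine Lp.ext ?_
  filter_upwards [coeFn_tensorFun f a, coeFn_tensorFun (tensorFun f a) x,
    coeFn_tensorFun f (a • x)] with t h1 h2 h3
  rw [h2, h3, h1, smul_eq_mul, mul_smul]

lemma tensorFun_mem {f : LOne ℂ} (hf : f ∈ HardyOne ℂ) (x : X) :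
    tensorFun f x ∈ HardyOne X := by
  let T : LOne ℂ →L[ℂ] LOne X := (ContinuousLinearMap.toSpanSingleton ℂ x).compLpL 1 _
  have hT : ∀ g, T g = tensorFun g x := fun g => rfl
  have hpoly : ∀ g ∈ analyticPolys ℂ, T g ∈ analyticPolys X := by
    intro g hg
    refine Submodule.span_induction (p := fun g _ => T g ∈ analyticPolys X) ?_ ?_ ?_ ?_ hg
    · rintro _ ⟨n, a, rfl⟩
      rw [hT, tensorFun_tensorFun]
      exact Submodule.subset_span ⟨n, _, rfl⟩
    · simp
    · intro g g' _ _ h h'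
      rw [map_add]
      exact add_mem h h'
    · intro c g _ h
      rw [map_smul]
      exact Submodule.smul_mem _ _ h
  exact map_mem_closure (f := T) T.continuous hf hpoly

variable (X) in
/-- The bilinear map `H¹ × X → H̃¹(X)`, `(h, x) ↦ h x`. -/
def hardyBilin : HardyOne ℂ →ₗ[ℂ] X →ₗ[ℂ] HardyOne X :=
  LinearMap.mk₂ ℂ (fun h x => ⟨tensorFun (h : LOne ℂ) x, tensorFun_mem h.2 x⟩)
    (fun f g x => Subtype.ext (LinearMap.map_add₂ (tensorFunₗ X) (f : LOne ℂ) g x))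
    (fun c f x => Subtype.ext (LinearMap.map_smul₂ (tensorFunₗ X) c (f : LOne ℂ) x))
    (fun f x y => Subtype.ext ((tensorFunₗ X (f : LOne ℂ)).map_add x y))
    (fun c f x => Subtype.ext ((tensorFunₗ X (f : LOne ℂ)).map_smul c x))

variable (X) in
/-- The canonical map from the algebraic tensor product `H¹ ⊗ X` to `H̃¹(X)`. -/
def canonAlg : AlgTensor (HardyOne ℂ) X →L[ℂ] HardyOne X :=
  liftAlg (hardyBilin X) fun h x => norm_tensorFun_le (h : LOne ℂ) x

variable (X) in
/-- The canonical map from the projective tensor product of `H¹` and `X` to `H̃¹(X)`: the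
continuous linear map with `h ⊗ x ↦ h x`. -/
def canon [CompleteSpace X] : ProjTensor (HardyOne ℂ) X →L[ℂ] HardyOne X :=
  (canonAlg X).extend
    (UniformSpace.Completion.toComplL (𝕜 := ℂ) (E := AlgTensor (HardyOne ℂ) X))

lemma canon_coe [CompleteSpace X] (u : AlgTensor (HardyOne ℂ) X) :
    canon X (u : ProjTensor (HardyOne ℂ) X) = canonAlg X u :=
  ContinuousLinearMap.extend_eq (canonAlg X)
    (e := UniformSpace.Completion.toComplL (𝕜 := ℂ) (E := AlgTensor (HardyOne ℂ) X))
    UniformSpace.Completion.denseRange_coe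
    (UniformSpace.Completion.isUniformInducing_coe _) u

lemma canon_mk [CompleteSpace X] (h : HardyOne ℂ) (x : X) :
    (canon X (AlgTensor.mk h x : ProjTensor (HardyOne ℂ) X) : LOne X)
      = tensorFun (h : LOne ℂ) x := by
  rw [canon_coe]
  exact congrArg Subtype.val (liftAlg_mk (hardyBilin X) _ h x)

variable (X) in
/-- `X` is `H¹`-projective if the canonical map is onto `H̃¹(X)`. -/
def IsHOneProjective [CompleteSpace X] : Prop := Function.Surjective (canon X)

variable (X) in
/-- The `H¹`-projectivity constant `η(X)`: the smallest `c ≥ 0` with `‖F‖ ≤ c ‖F‖_{H̃¹(X)}` for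
all `F` in the projective tensor product. It is meaningful when `X` is `H¹`-projective. -/
def eta [CompleteSpace X] : ℝ :=
  sInf {c : ℝ | 0 ≤ c ∧ ∀ F : ProjTensor (HardyOne ℂ) X, ‖F‖ ≤ c * ‖canon X F‖}

/-- Finitely-spectral operators `L¹ → X`. -/
def FinSpecL (u : LOne ℂ →L[ℂ] X) : Prop :=
  ∃ k : ℕ, 0 < k ∧ ∀ n : ℤ, n ∉ Set.Icc (-(k : ℤ)) (k : ℤ) → u (expo n) = 0

/-- Finitely-spectral operators `H¹ → X`. -/
def FinSpecH (v : HardyOne ℂ →L[ℂ] X) : Prop :=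
  ∃ k : ℕ, 0 < k ∧ ∀ n : ℕ, k < n → v (expoH n) = 0

variable (X) in
/-- Every finitely-spectral `v : H¹ → X` extends to a finitely-spectral operator on `L¹` of norm
at most `lam ‖v‖`. -/
def IsExtensionConstant (lam : ℝ) : Prop :=
  0 ≤ lam ∧ ∀ v : HardyOne ℂ →L[ℂ] X, FinSpecH v →
    ∃ w : LOne ℂ →L[ℂ] X, FinSpecL w ∧ (∀ f : HardyOne ℂ, w (f : LOne ℂ) = v f) ∧
      ‖w‖ ≤ lam * ‖v‖

end Hardy

end HOne

end

noncomputable section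

namespace HOne

/-! Both conditions amount to one inequality, `‖u‖ ≤ c * ‖canon u‖` on the projective tensor product
P of H¹ and X*. Fejér means act contractively on P, converge there to the identity, and depend only
on the Fourier coefficients of the image. Hence `canon` is injective, and by the open mapping
theorem surjectivity is equivalent to such an inequality (`isHOneProjective_iff`).

From extensions to the inequality (`IsExtensionConstant.norm_le`): it suffices to bound the Fejér
means of u. The coefficients of u define a functional on finite sequences x in X. Each x gives a
finitely-spectral operator on H¹. Its extension to L¹ pairs with `canon u` and bounds the functional
by lam times `‖canon u‖` times the norm of that operator. This norm is almost attained on finitely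
many h_j independent of x. Hahn–Banach in X^m with the sup norm then gives ξ_j in X* with controlled
sum of norms, and the Fejér mean of u is the sum of the tensors (Fejér mean of h_j) ⊗ ξ_j.

From the inequality to extensions (`norm_mk_sumOp_le`): the extensions of v form a coset of the
finitely-spectral operators vanishing on H¹, so the least norm is a quotient seminorm. A norming
functional of the quotient has coefficients y_n in X*. Fejér sums of them are polynomials whose
L¹(X*) norm is almost at most 1, by testing against simple functions. The inequality lifts this
bound to P, where v acts with norm at most `‖v‖`. The infimum need not be attained, so every lam > c
is obtained, which suffices for the equality of constants. -/

lemma lOne_integrable {Y : Type*} [NormedAddCommGroup Y] (f : LOne Y) :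
    Integrable f AddCircle.haarAddCircle :=
  L1.integrable_coeFn f

/-! ### Integral operators on vector-valued L¹ and Fourier coefficients -/

section Coefficients

variable {Y Z : Type*} [NormedAddCommGroup Y] [NormedSpace ℂ Y]
  [NormedAddCommGroup Z] [NormedSpace ℂ Z]

lemma aestronglyMeasurable_apply {L : UnitAddCircle → Y →L[ℂ] Z}
    (hL : AEStronglyMeasurable L AddCircle.haarAddCircle) {f : UnitAddCircle → Y}
    (hf : AEStronglyMeasurable f AddCircle.haarAddCircle) :
    AEStronglyMeasurable (fun t => L t (f t)) AddCircle.haarAddCircle :=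
  isBoundedBilinearMap_apply.continuous.comp_aestronglyMeasurable₂ hL hf

lemma integrable_apply {L : UnitAddCircle → Y →L[ℂ] Z}
    (hL : AEStronglyMeasurable L AddCircle.haarAddCircle) {C : ℝ} (hC : ∀ t, ‖L t‖ ≤ C)
    (f : LOne Y) : Integrable (fun t => L t (f t)) AddCircle.haarAddCircle := by
  refine ((lOne_integrable f).norm.const_mul C).mono'
    (aestronglyMeasurable_apply hL (lOne_integrable f).aestronglyMeasurable) ?_
  exact Filter.Eventually.of_forall fun t =>
    (L t).le_of_opNorm_le (hC t) _

/-- The operator `f ↦ ∫ L(t) f(t) dt` on `L¹(𝕋; Y)` given by a bounded family of operators. -/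
def integralOp (L : UnitAddCircle → Y →L[ℂ] Z)
    (hL : AEStronglyMeasurable L AddCircle.haarAddCircle) (C : ℝ) (hC : ∀ t, ‖L t‖ ≤ C) :
    LOne Y →L[ℂ] Z :=
  LinearMap.mkContinuous
    { toFun := fun f => ∫ t, L t (f t) ∂AddCircle.haarAddCircle
      map_add' := fun f g => by
        rw [← integral_add (integrable_apply hL hC f) (integrable_apply hL hC g)]
        refine integral_congr_ae ?_
        filter_upwards [Lp.coeFn_add f g] with t ht
        rw [ht, Pi.add_apply, map_add]
      map_smul' := fun c f => by
        rw [RingHom.id_apply, ← integral_smul]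
        refine integral_congr_ae ?_
        filter_upwards [Lp.coeFn_smul c f] with t ht
        rw [ht, Pi.smul_apply, map_smul] } C <| by
    intro f
    refine (norm_integral_le_integral_norm _).trans ?_
    rw [L1.norm_eq_integral_norm, ← integral_const_mul]
    exact integral_mono (integrable_apply hL hC f).norm ((lOne_integrable f).norm.const_mul C)
      fun t => (L t).le_of_opNorm_le (hC t) _

lemma norm_integralOp_le (L : UnitAddCircle → Y →L[ℂ] Z)
    (hL : AEStronglyMeasurable L AddCircle.haarAddCircle) {C : ℝ} (hC : ∀ t, ‖L t‖ ≤ C)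
    (hC0 : 0 ≤ C) : ‖integralOp L hL C hC‖ ≤ C :=
  LinearMap.mkContinuous_norm_le _ hC0 _

variable (Y) in
/-- The `n`-th Fourier coefficient as an operator on `L¹(𝕋; Y)`. -/
def coeff (n : ℤ) : LOne Y →L[ℂ] Y :=
  integralOp (fun t => (fourier (-n) t : ℂ) • ContinuousLinearMap.id ℂ Y)
    (Continuous.aestronglyMeasurable (by fun_prop)) 1 fun t => by
      rw [norm_smul, fourier_apply, Circle.norm_coe, one_mul]
      exact ContinuousLinearMap.norm_id_le

lemma coeff_apply (n : ℤ) (f : LOne Y) :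
    coeff Y n f = ∫ t, (fourier (-n) t : ℂ) • f t ∂AddCircle.haarAddCircle := rfl

lemma norm_coeff_le (n : ℤ) : ‖coeff Y n‖ ≤ 1 :=
  norm_integralOp_le _ _ _ zero_le_one

lemma coeff_tensorFun [CompleteSpace Y] (n : ℤ) (f : LOne ℂ) (y : Y) :
    coeff Y n (tensorFun f y) = coeff ℂ n f • y := by
  rw [coeff_apply, coeff_apply, ← integral_smul_const]
  refine integral_congr_ae ?_
  filter_upwards [coeFn_tensorFun f y] with t ht
  rw [ht, smul_smul, smul_eq_mul]

lemma integral_fourier (n : ℤ) :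
    ∫ t : UnitAddCircle, (fourier n t : ℂ) ∂AddCircle.haarAddCircle = if n = 0 then 1 else 0 := by
  split_ifs with h
  · simp [h]
  -- Translation by `1 / (2n)` changes the sign of the character but not the integral.
  · exact integral_eq_zero_of_add_right_eq_neg (μ := AddCircle.haarAddCircle)
      (fourier_add_half_inv_index h one_pos)

lemma coeFn_expo (n : ℤ) : expo n =ᵐ[AddCircle.haarAddCircle] fourier n :=
  coeFn_fourierLp 1 n

lemma coeff_expo (n k : ℤ) : coeff ℂ n (expo k) = if n = k then 1 else 0 := by
  have h : coeff ℂ n (expo k)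
      = ∫ t : UnitAddCircle, (fourier (-n + k) t : ℂ) ∂AddCircle.haarAddCircle := by
    rw [coeff_apply]
    refine integral_congr_ae ?_
    filter_upwards [coeFn_expo k] with t ht
    rw [ht, fourier_add, smul_eq_mul]
  rw [h, integral_fourier]
  refine if_congr ?_ rfl rfl
  omega

lemma norm_expo_le (n : ℤ) : ‖expo n‖ ≤ 1 := by
  rw [L1.norm_eq_integral_norm]
  refine le_of_eq ?_
  rw [integral_congr_ae (g := fun _ => (1 : ℝ))]
  · simp
  · filter_upwards [coeFn_expo n] with t ht
    rw [ht, fourier_apply, Circle.norm_coe]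

end Coefficients

/-! ### Convolution with a trigonometric polynomial -/

section Convolution

variable {ι : Type*}

/-- A multiplier operator with finite spectrum is a convolution operator, and is bounded on `L¹` by
the `L¹`-norm of its kernel. -/
lemma norm_sum_coeff_smul_expo_le (s : Finset ι) (c : ι → ℂ) (n : ι → ℤ) (f : LOne ℂ) :
    ‖∑ i ∈ s, (c i * coeff ℂ (n i) f) • expo (n i)‖ ≤
      (∫ t : UnitAddCircle, ‖∑ i ∈ s, c i * fourier (n i) t‖ ∂AddCircle.haarAddCircle) * ‖f‖ := by
  set K : UnitAddCircle → ℂ := fun t => ∑ i ∈ s, c i * fourier (n i) t with hK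
  have hKc : Continuous K := by fun_prop
  have hKi : Integrable K AddCircle.haarAddCircle :=
    hKc.integrable_of_hasCompactSupport (HasCompactSupport.of_compactSpace K)
  have hf := lOne_integrable f
  have hae : ∀ᵐ t ∂AddCircle.haarAddCircle,
      (∑ i ∈ s, (c i * coeff ℂ (n i) f) • expo (n i) : LOne ℂ) t
        = ∫ r, K (t - r) * f r ∂AddCircle.haarAddCircle := by
    have h1 : ∀ᵐ t ∂AddCircle.haarAddCircle, ∀ i ∈ s,
        ((c i * coeff ℂ (n i) f) • expo (n i) : LOne ℂ) t
          = c i * coeff ℂ (n i) f * fourier (n i) t := by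
      refine (Filter.eventually_all_finset s).2 fun i _ => ?_
      filter_upwards [Lp.coeFn_smul (c i * coeff ℂ (n i) f) (expo (n i)), coeFn_expo (n i)]
        with t h1 h2
      rw [h1, Pi.smul_apply, h2, smul_eq_mul]
    filter_upwards [h1, Lp.coeFn_finsetSum s fun i => (c i * coeff ℂ (n i) f) • expo (n i)]
      with t h1 h2
    rw [h2, Finset.sum_apply, Finset.sum_congr rfl h1]
    simp only [hK, Finset.sum_mul]
    rw [integral_finsetSum]
    · refine Finset.sum_congr rfl fun i _ => ?_
      rw [coeff_apply, mul_right_comm, ← integral_const_mul]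
      refine integral_congr_ae (Filter.Eventually.of_forall fun r => ?_)
      have : (fourier (n i) (t - r) : ℂ) = fourier (n i) t * fourier (-n i) r := by
        simp [fourier_apply, sub_eq_add_neg, AddCircle.toCircle_add]
      simp only [this, smul_eq_mul]
      ring
    · intro i _
      refine (hf.norm.const_mul ‖c i‖).mono' ?_ ?_
      · exact (Continuous.aestronglyMeasurable (by fun_prop)).mul hf.aestronglyMeasurable
      · refine Filter.Eventually.of_forall fun r => ?_
        rw [norm_mul, norm_mul, fourier_apply, Circle.norm_coe, mul_one]
  -- What remains is Young's inequality for `K * f`: Tonelli and translation invariance, in `ℝ≥0∞`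
  -- to avoid integrability side conditions.
  rw [← ENNReal.ofReal_le_ofReal_iff (by positivity), L1.ofReal_norm_eq_lintegral,
    ENNReal.ofReal_mul (by positivity), L1.ofReal_norm_eq_lintegral,
    ofReal_integral_norm_eq_lintegral_enorm hKi]
  calc ∫⁻ t, ‖(∑ i ∈ s, (c i * coeff ℂ (n i) f) • expo (n i) : LOne ℂ) t‖ₑ ∂AddCircle.haarAddCircle
      = ∫⁻ t, ‖∫ r, K (t - r) * f r ∂AddCircle.haarAddCircle‖ₑ ∂AddCircle.haarAddCircle :=
        lintegral_congr_ae (hae.mono fun t ht => congrArg enorm ht)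
    _ ≤ ∫⁻ t, ∫⁻ r, ‖K (t - r)‖ₑ * ‖f r‖ₑ ∂AddCircle.haarAddCircle ∂AddCircle.haarAddCircle :=
        lintegral_mono fun t => by
          simpa only [enorm_mul] using enorm_integral_le_lintegral_enorm
            (μ := AddCircle.haarAddCircle) (fun r => K (t - r) * f r)
    _ = ∫⁻ r, ∫⁻ t, ‖K (t - r)‖ₑ * ‖f r‖ₑ ∂AddCircle.haarAddCircle ∂AddCircle.haarAddCircle := by
        refine lintegral_lintegral_swap ?_
        have h1 : AEMeasurable (fun p : UnitAddCircle × UnitAddCircle => ‖K (p.1 - p.2)‖ₑ)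
            (AddCircle.haarAddCircle.prod AddCircle.haarAddCircle) :=
          (Continuous.measurable (by fun_prop)).aemeasurable
        exact h1.mul (hf.aestronglyMeasurable.enorm.comp_quasiMeasurePreserving
          Measure.quasiMeasurePreserving_snd)
    _ = ∫⁻ r, (∫⁻ t, ‖K t‖ₑ ∂AddCircle.haarAddCircle) * ‖f r‖ₑ ∂AddCircle.haarAddCircle := by
        refine lintegral_congr fun r => ?_
        rw [lintegral_mul_const _ (Continuous.measurable (by fun_prop)),
          lintegral_sub_right_eq_self (fun t => ‖K t‖ₑ) r]
    _ = (∫⁻ t, ‖K t‖ₑ ∂AddCircle.haarAddCircle) * ∫⁻ r, ‖f r‖ₑ ∂AddCircle.haarAddCircle :=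
        lintegral_const_mul'' _ hf.aestronglyMeasurable.enorm

end Convolution

/-! ### Fejér means on L¹ -/

section Fejer

/-- The Fejér mean of order `N`, as an operator on `L¹`. -/
def fejer (N : ℕ) : LOne ℂ →L[ℂ] LOne ℂ :=
  ∑ p ∈ Finset.range N ×ˢ Finset.range N,
    (N : ℂ)⁻¹ • (coeff ℂ ((p.1 : ℤ) - p.2)).smulRight (expo ((p.1 : ℤ) - p.2))

lemma fejer_apply (N : ℕ) (f : LOne ℂ) :
    fejer N f = ∑ p ∈ Finset.range N ×ˢ Finset.range N,
      ((N : ℂ)⁻¹ * coeff ℂ ((p.1 : ℤ) - p.2) f) • expo ((p.1 : ℤ) - p.2) := by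
  simp [fejer, smul_smul]

/-- The Fejér kernel is nonnegative with integral one, so its `L¹`-norm is at most one. -/
lemma integral_norm_fejerKernel_le (N : ℕ) :
    ∫ t : UnitAddCircle, ‖∑ p ∈ Finset.range N ×ˢ Finset.range N,
      (N : ℂ)⁻¹ * fourier ((p.1 : ℤ) - p.2) t‖ ∂AddCircle.haarAddCircle ≤ 1 := by
  set K : UnitAddCircle → ℂ := fun t => ∑ p ∈ Finset.range N ×ˢ Finset.range N,
      (N : ℂ)⁻¹ * fourier ((p.1 : ℤ) - p.2) t with hK
  -- The double sum over (a, b) is a square modulus, so the kernel equals its own absolute value and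
  -- its L¹ norm is its zeroth coefficient.
  have hsq : ∀ t, K t =
      (((N : ℝ)⁻¹ * ‖∑ a ∈ Finset.range N, (fourier (a : ℤ) t : ℂ)‖ ^ 2 : ℝ) : ℂ) := by
    intro t
    rw [Complex.ofReal_mul, Complex.ofReal_pow, ← Complex.mul_conj', map_sum, Finset.sum_mul_sum,
      ← Finset.sum_product', Finset.mul_sum, hK]
    refine Finset.sum_congr rfl fun p _ => ?_
    rw [← fourier_neg, ← fourier_add, sub_eq_add_neg]
    simp
  have hn : ∀ t, ((‖K t‖ : ℝ) : ℂ) = K t := by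
    intro t
    rw [hsq t, Complex.norm_real, Real.norm_of_nonneg (by positivity)]
  have hint : ((∫ t, ‖K t‖ ∂AddCircle.haarAddCircle : ℝ) : ℂ) = (N : ℂ)⁻¹ * N := by
    rw [← integral_complex_ofReal, integral_congr_ae (Filter.Eventually.of_forall hn), hK,
      integral_finsetSum]
    · simp only [integral_const_mul, integral_fourier]
      rw [← Finset.mul_sum, Finset.sum_product]
      have : ∀ a ∈ Finset.range N, ∑ b ∈ Finset.range N,
          (if ((a : ℤ) - b) = 0 then (1 : ℂ) else 0) = 1 := by
        intro a ha
        simp only [sub_eq_zero, Nat.cast_inj, Finset.sum_ite_eq, ha, if_true]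
      rw [Finset.sum_congr rfl this]
      simp
    · intro p _
      exact Continuous.integrable_of_hasCompactSupport (by fun_prop)
        (HasCompactSupport.of_compactSpace _)
  have : (∫ t, ‖K t‖ ∂AddCircle.haarAddCircle : ℝ) = (N : ℝ)⁻¹ * N := by
    apply Complex.ofReal_injective
    rw [hint]
    push_cast
    rfl
  rw [this]
  -- The value is 0 for `N = 0` and 1 otherwise.
  exact inv_mul_le_one

lemma norm_fejer_apply_le (N : ℕ) (f : LOne ℂ) : ‖fejer N f‖ ≤ ‖f‖ := by
  rw [fejer_apply]
  refine (norm_sum_coeff_smul_expo_le _ (fun _ => (N : ℂ)⁻¹) _ f).trans ?_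
  exact mul_le_of_le_one_left (norm_nonneg _) (integral_norm_fejerKernel_le N)

lemma norm_fejer_le (N : ℕ) : ‖fejer N‖ ≤ 1 :=
  ContinuousLinearMap.opNorm_le_bound _ zero_le_one fun f => by
    simpa using norm_fejer_apply_le N f

/-- The multiplier of the Fejér mean of order `N`. -/
def fejerWeight (N : ℕ) (k : ℤ) : ℂ :=
  (N : ℂ)⁻¹ * ((Finset.range N ×ˢ Finset.range N).filter fun p => (p.1 : ℤ) - p.2 = k).card

lemma fejer_expo (N : ℕ) (k : ℤ) : fejer N (expo k) = fejerWeight N k • expo k := by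
  rw [fejer_apply]
  simp only [coeff_expo, mul_ite, mul_one, mul_zero, ite_smul, zero_smul]
  rw [← Finset.sum_filter, Finset.sum_congr rfl (g := fun _ => (N : ℂ)⁻¹ • expo k),
    Finset.sum_const, fejerWeight, mul_comm, mul_smul, Nat.cast_smul_eq_nsmul]
  intro p hp
  rw [(Finset.mem_filter.1 hp).2]

lemma fejerWeight_eq_zero {N : ℕ} {k : ℤ} (h : k ∉ Set.Ioo (-(N : ℤ)) N) :
    fejerWeight N k = 0 := by
  rw [fejerWeight, Finset.filter_eq_empty_iff.2, Finset.card_empty, Nat.cast_zero, mul_zero]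
  rintro p hp rfl
  simp only [Finset.mem_product, Finset.mem_range] at hp
  exact h ⟨by omega, by omega⟩

lemma fejerWeight_natCast {N k : ℕ} (h : k ≤ N) : fejerWeight N k = (N : ℂ)⁻¹ * (N - k) := by
  have : ((Finset.range N ×ˢ Finset.range N).filter fun p => (p.1 : ℤ) - p.2 = k).card = N - k := by
    rw [← Finset.card_range (N - k)]
    refine Finset.card_bij' (fun p _ => p.2) (fun b _ => (b + k, b)) ?_ ?_ ?_ ?_
    · intro p hp
      simp only [Finset.mem_filter, Finset.mem_product, Finset.mem_range] at hp ⊢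
      omega
    · intro b hb
      simp only [Finset.mem_filter, Finset.mem_product, Finset.mem_range] at hb ⊢
      push_cast
      omega
    · intro p hp
      simp only [Finset.mem_filter, Finset.mem_product, Finset.mem_range] at hp
      ext <;> simp
      omega
    · intro b _
      rfl
  rw [fejerWeight, this, Nat.cast_sub h]

lemma fejerWeight_ne_zero {N k : ℕ} (h : k < N) : fejerWeight N k ≠ 0 := by
  rw [fejerWeight_natCast h.le, ← Nat.cast_sub h.le]
  have h1 : N - k ≠ 0 := by omega
  have h2 : N ≠ 0 := by omega
  positivity

lemma tendsto_fejerWeight (k : ℕ) :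
    Filter.Tendsto (fun N => fejerWeight N k) Filter.atTop (nhds 1) := by
  have h : Filter.Tendsto (fun N : ℕ => 1 - (k : ℂ) * (N : ℂ)⁻¹) Filter.atTop (nhds 1) := by
    simpa using tendsto_const_nhds.sub
      ((tendsto_inv_atTop_nhds_zero_nat (𝕜 := ℂ)).const_mul (k : ℂ))
  refine h.congr' ?_
  filter_upwards [Filter.eventually_ge_atTop (k + 1)] with N hN
  have : (N : ℂ) ≠ 0 := by
    have : N ≠ 0 := by omega
    exact_mod_cast this
  rw [fejerWeight_natCast (by omega)]
  field_simp

end Fejer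

/-! ### Bounded operators on the projective tensor product -/

section ProjectiveTensor

variable {E F Z : Type*} [NormedAddCommGroup E] [NormedSpace ℂ E]
  [NormedAddCommGroup F] [NormedSpace ℂ F] [NormedAddCommGroup Z] [NormedSpace ℂ Z]

lemma norm_algTensor_mk_le (x : E) (y : F) : ‖AlgTensor.mk x y‖ ≤ ‖x‖ * ‖y‖ :=
  csInf_le (repSums_bddBelow _) (mk_mem_repSums x y)

lemma algTensor_norm_le (S : AlgTensor E F →ₗ[ℂ] Z) {C : ℝ} (hC : 0 ≤ C)
    (h : ∀ x y, ‖S (AlgTensor.mk x y)‖ ≤ C * (‖x‖ * ‖y‖)) (u : AlgTensor E F) :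
    ‖S u‖ ≤ C * ‖u‖ := by
  rcases hC.eq_or_lt with rfl | hC
  · obtain ⟨r, n, x, y, rfl, -⟩ := repSums_nonempty u
    rw [map_sum, zero_mul]
    exact (norm_sum_le _ _).trans (Finset.sum_nonpos fun i _ => (h _ _).trans (zero_mul _).le)
  rw [← div_le_iff₀' hC]
  refine le_csInf (repSums_nonempty u) ?_
  rintro r ⟨n, x, y, rfl, rfl⟩
  rw [div_le_iff₀' hC, map_sum, Finset.mul_sum]
  exact (norm_sum_le _ _).trans (Finset.sum_le_sum fun i _ => h _ _)

variable (E F) in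
/-- The elementary tensors, as a bounded bilinear map into the projective tensor product. -/
def tensor : E →L[ℂ] F →L[ℂ] ProjTensor E F :=
  LinearMap.mkContinuous₂
    ((TensorProduct.mk ℂ E F).compr₂
      (UniformSpace.Completion.toComplL (𝕜 := ℂ) (E := AlgTensor E F) : AlgTensor E F →ₗ[ℂ] _))
    1 <| by
    intro x y
    rw [one_mul]
    exact (UniformSpace.Completion.norm_coe (AlgTensor.mk x y)).trans_le (norm_algTensor_mk_le x y)

lemma tensor_apply (x : E) (y : F) : tensor E F x y = (AlgTensor.mk x y : ProjTensor E F) := rfl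

lemma norm_tensor_le (x : E) (y : F) : ‖tensor E F x y‖ ≤ ‖x‖ * ‖y‖ :=
  (UniformSpace.Completion.norm_coe (AlgTensor.mk x y)).trans_le (norm_algTensor_mk_le x y)

lemma projTensor_norm_le (S : ProjTensor E F →L[ℂ] Z) {C : ℝ} (hC : 0 ≤ C)
    (h : ∀ x y, ‖S (tensor E F x y)‖ ≤ C * (‖x‖ * ‖y‖)) (u : ProjTensor E F) :
    ‖S u‖ ≤ C * ‖u‖ := by
  induction u using UniformSpace.Completion.induction_on with
  | hp => exact isClosed_le (by fun_prop) (by fun_prop)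
  | ih u =>
    rw [UniformSpace.Completion.norm_coe]
    exact algTensor_norm_le (S.toLinearMap ∘ₗ
      (UniformSpace.Completion.toComplL (𝕜 := ℂ) (E := AlgTensor E F) : AlgTensor E F →ₗ[ℂ] _))
      hC h u

end ProjectiveTensor

/-! ### Density of monomials -/

section HardyDense

variable {Y Z : Type*} [NormedAddCommGroup Y] [NormedSpace ℂ Y]
  [NormedAddCommGroup Z] [NormedSpace ℂ Z]

/-- The monomial `e^{ikθ} y` in the vector-valued Hardy space. -/
def monomial (k : ℕ) (y : Y) : HardyOne Y := ⟨tensorFun (expo k) y, tensorFun_expo_mem k y⟩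

lemma monomial_eq_smul (k : ℕ) (a : ℂ) : monomial k a = a • expoH k := by
  refine Subtype.ext ?_
  have h := (tensorFunₗ ℂ (expo k)).map_smul a 1
  rw [smul_eq_mul, mul_one, tensorFunₗ_apply, tensorFunₗ_apply, tensorFun_one] at h
  exact h

lemma hardy_induction (T : Submodule ℂ (HardyOne Y)) (hT : IsClosed (T : Set (HardyOne Y)))
    (h : ∀ k y, monomial k y ∈ T) (f : HardyOne Y) : f ∈ T := by
  have hd : DenseRange (Set.inclusion (Submodule.le_topologicalClosure (analyticPolys Y))) :=
    (denseRange_inclusion_iff _).2 subset_rfl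
  refine hd.induction_on (p := fun f => f ∈ T) f hT ?_
  rintro ⟨g, hg⟩
  refine Submodule.span_induction (p := fun g hg => Set.inclusion
    (Submodule.le_topologicalClosure (analyticPolys Y)) ⟨g, hg⟩ ∈ T) ?_ ?_ ?_ ?_ hg
  · rintro _ ⟨n, x, rfl⟩
    exact h n x
  · exact T.zero_mem
  · intro x y _ _ hx hy
    exact T.add_mem hx hy
  · intro a x _ hx
    exact T.smul_mem a hx

lemma hardy_scalar_ext {S T : HardyOne ℂ →L[ℂ] Z} (h : ∀ k, S (expoH k) = T (expoH k)) : S = T := by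
  ext f
  refine hardy_induction (LinearMap.eqLocus S.toLinearMap T.toLinearMap)
    (isClosed_eq S.continuous T.continuous) (fun k a => ?_) f
  change S (monomial k a) = T (monomial k a)
  rw [monomial_eq_smul, map_smul, map_smul, h]

lemma projTensor_induction (T : Submodule ℂ (ProjTensor (HardyOne ℂ) Y))
    (hT : IsClosed (T : Set (ProjTensor (HardyOne ℂ) Y)))
    (h : ∀ k y, tensor (HardyOne ℂ) Y (expoH k) y ∈ T) (u : ProjTensor (HardyOne ℂ) Y) : u ∈ T := by
  induction u using UniformSpace.Completion.induction_on with
  | hp => exact hT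
  | ih u =>
    induction u using TensorProduct.induction_on with
    | zero => exact T.zero_mem
    | add u v hu hv =>
      exact (UniformSpace.Completion.coe_add (α := AlgTensor (HardyOne ℂ) Y) u v) ▸
        T.add_mem hu hv
    | tmul f y =>
      refine hardy_induction (T.comap ((tensor (HardyOne ℂ) Y).flip y).toLinearMap)
        (hT.preimage ((tensor (HardyOne ℂ) Y).flip y).continuous) (fun k a => ?_) f
      rw [monomial_eq_smul]
      exact Submodule.smul_mem _ a (h k y)

lemma projTensor_ext {S T : ProjTensor (HardyOne ℂ) Y →L[ℂ] Z}
    (h : ∀ k y, S (tensor (HardyOne ℂ) Y (expoH k) y) = T (tensor (HardyOne ℂ) Y (expoH k) y)) :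
    S = T := by
  ext u
  exact projTensor_induction (LinearMap.eqLocus S.toLinearMap T.toLinearMap)
    (isClosed_eq S.continuous T.continuous) h u

end HardyDense

/-! ### Fejér means on H¹ and on the tensor product; injectivity of the canonical map -/

section FejerHardy

/-- The Fejér mean of order `N`, as an operator on `H¹`. -/
def fejerH (N : ℕ) : HardyOne ℂ →L[ℂ] HardyOne ℂ :=
  ∑ n ∈ Finset.range N, fejerWeight N n •
    ((coeff ℂ n).comp (HardyOne ℂ).subtypeL).smulRight (expoH n)

lemma fejerH_apply (N : ℕ) (f : HardyOne ℂ) :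
    fejerH N f = ∑ n ∈ Finset.range N, (fejerWeight N n * coeff ℂ n f) • expoH n := by
  simp [fejerH, smul_smul]

lemma fejerH_expoH (N k : ℕ) : fejerH N (expoH k) = fejerWeight N k • expoH k := by
  rw [fejerH_apply]
  have h : ∀ n : ℕ, coeff ℂ n (expoH k : LOne ℂ) = if n = k then 1 else 0 := fun n => by
    refine (coeff_expo n k).trans (if_congr Nat.cast_inj rfl rfl)
  simp only [h, mul_ite, mul_one, mul_zero, ite_smul, zero_smul, Finset.sum_ite_eq',
    Finset.mem_range]
  split_ifs with hk
  · rfl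
  · rw [fejerWeight_eq_zero (fun h => hk (by exact_mod_cast h.2)), zero_smul]

lemma coe_fejerH (N : ℕ) (f : HardyOne ℂ) : (fejerH N f : LOne ℂ) = fejer N f := by
  have : (HardyOne ℂ).subtypeL.comp (fejerH N) = (fejer N).comp (HardyOne ℂ).subtypeL := by
    refine hardy_scalar_ext fun k => ?_
    change (fejerH N (expoH k) : LOne ℂ) = fejer N (expo k)
    rw [fejerH_expoH, fejer_expo]
    rfl
  exact DFunLike.congr_fun this f

lemma norm_fejerH_apply_le (N : ℕ) (f : HardyOne ℂ) : ‖fejerH N f‖ ≤ ‖f‖ := by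
  change ‖(fejerH N f : LOne ℂ)‖ ≤ ‖(f : LOne ℂ)‖
  rw [coe_fejerH]
  exact norm_fejer_apply_le N f

variable (Y : Type*) [NormedAddCommGroup Y] [NormedSpace ℂ Y] [CompleteSpace Y]

/-- The `n`-th coefficient of the image of an element of the projective tensor product. -/
def coeffP (n : ℕ) : ProjTensor (HardyOne ℂ) Y →L[ℂ] Y :=
  (coeff Y n).comp ((HardyOne Y).subtypeL.comp (canon Y))

variable {Y} in
lemma coeffP_apply (n : ℕ) (u : ProjTensor (HardyOne ℂ) Y) :
    coeffP Y n u = coeff Y n (canon Y u : LOne Y) := rfl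

variable {Y} in
lemma coeffP_tensor (n : ℕ) (f : HardyOne ℂ) (y : Y) :
    coeffP Y n (tensor _ Y f y) = coeff ℂ n (f : LOne ℂ) • y := by
  rw [coeffP_apply, tensor_apply, canon_mk, coeff_tensorFun]

/-- The Fejér mean of order `N`, as an operator on the projective tensor product of `H¹`
and `Y`. -/
def fejerP (N : ℕ) : ProjTensor (HardyOne ℂ) Y →L[ℂ] ProjTensor (HardyOne ℂ) Y :=
  ∑ n ∈ Finset.range N, fejerWeight N n • (tensor _ Y (expoH n)).comp (coeffP Y n)

variable {Y}

lemma fejerP_apply (N : ℕ) (u : ProjTensor (HardyOne ℂ) Y) :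
    fejerP Y N u =
      ∑ n ∈ Finset.range N, fejerWeight N n • tensor _ Y (expoH n) (coeffP Y n u) := by
  simp [fejerP]

lemma fejerP_tensor (N : ℕ) (f : HardyOne ℂ) (y : Y) :
    fejerP Y N (tensor _ Y f y) = tensor _ Y (fejerH N f) y := by
  rw [fejerP_apply, fejerH_apply, map_sum, sum_apply]
  refine Finset.sum_congr rfl fun n _ => ?_
  rw [coeffP_tensor, map_smul, map_smul, smul_smul]
  rfl

/-- On elementary tensors `fejerP` is `fejerH` tensored with the identity, and the projective norm
makes such operators contractive as soon as `fejerH` is. -/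
lemma norm_fejerP_apply_le (N : ℕ) (u : ProjTensor (HardyOne ℂ) Y) : ‖fejerP Y N u‖ ≤ ‖u‖ := by
  rw [← one_mul ‖u‖]
  refine projTensor_norm_le _ zero_le_one (fun f y => ?_) u
  rw [fejerP_tensor, one_mul]
  exact (norm_tensor_le _ _).trans
    (mul_le_mul_of_nonneg_right (norm_fejerH_apply_le N f) (norm_nonneg _))

/-- Uniform contractivity makes the set of u with convergence closed, and on monomials only the
convergence of the weights to 1 is needed. -/
lemma tendsto_fejerP (u : ProjTensor (HardyOne ℂ) Y) :
    Filter.Tendsto (fun N => fejerP Y N u) Filter.atTop (nhds u) := by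
  let T : Submodule ℂ (ProjTensor (HardyOne ℂ) Y) :=
    { carrier := {u | Filter.Tendsto (fun N => fejerP Y N u) Filter.atTop (nhds u)}
      zero_mem' := by simp
      add_mem' := fun {a b} ha hb => by
        simpa only [Set.mem_ofPred_eq, map_add] using Filter.Tendsto.add ha hb
      smul_mem' := fun c a ha => by
        simpa only [Set.mem_ofPred_eq, map_smul] using Filter.Tendsto.const_smul ha c }
  refine projTensor_induction T ?_ (fun k y => ?_) u
  · refine isClosed_of_closure_subset fun a ha => ?_
    refine Metric.tendsto_atTop.2 fun ε hε => ?_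
    obtain ⟨b, hb, hab⟩ := Metric.mem_closure_iff.1 ha (ε / 3) (by positivity)
    obtain ⟨N, hN⟩ := Metric.tendsto_atTop.1 (show Filter.Tendsto (fun N => fejerP Y N b)
      Filter.atTop (nhds b) from hb) (ε / 3) (by positivity)
    refine ⟨N, fun n hn => ?_⟩
    have h1 : dist (fejerP Y n a) (fejerP Y n b) ≤ dist a b := by
      rw [dist_eq_norm, dist_eq_norm, ← map_sub]
      exact norm_fejerP_apply_le n _
    have h2 := dist_triangle4 (fejerP Y n a) (fejerP Y n b) b a
    have h3 := hN n hn
    rw [dist_comm b a] at h2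
    linarith
  · change Filter.Tendsto (fun N => fejerP Y N (tensor _ Y (expoH k) y)) Filter.atTop
      (nhds (tensor _ Y (expoH k) y))
    have : ∀ N, fejerP Y N (tensor _ Y (expoH k) y)
        = fejerWeight N k • tensor _ Y (expoH k) y := fun N => by
      rw [fejerP_tensor, fejerH_expoH, map_smul]
      rfl
    simp only [this]
    simpa using (tendsto_fejerWeight k).smul_const (tensor _ Y (expoH k) y)

/-- Each Fejér mean of u is built from the coefficients of `canon Y u`. If these vanish, u is a
limit of zeros. -/
lemma canon_injective : Function.Injective (canon Y) := by
  refine (injective_iff_map_eq_zero _).2 fun u hu => ?_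
  refine tendsto_nhds_unique (tendsto_fejerP u) ?_
  have : ∀ N, fejerP Y N u = 0 := fun N => by
    simp [fejerP_apply, coeffP_apply, hu]
  simp only [this]
  exact tendsto_const_nhds

lemma canon_tensor_expoH (k : ℕ) (y : Y) : canon Y (tensor _ Y (expoH k) y) = monomial k y :=
  Subtype.ext (canon_mk (expoH k) y)

/-- Forwards, injectivity and the open mapping theorem give a bounded inverse. Backwards, a map
bounded below on a complete space has closed range, and this range contains the monomials. -/
lemma isHOneProjective_iff : IsHOneProjective Y ↔
    ∃ c : ℝ, 0 ≤ c ∧ ∀ u : ProjTensor (HardyOne ℂ) Y, ‖u‖ ≤ c * ‖canon Y u‖ := by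
  constructor
  · intro h
    let e := ContinuousLinearEquiv.ofBijective (canon Y)
      (LinearMap.ker_eq_bot.2 canon_injective) (LinearMap.range_eq_top.2 h)
    refine ⟨‖(e.symm : HardyOne Y →L[ℂ] ProjTensor (HardyOne ℂ) Y)‖,
      ContinuousLinearMap.opNorm_nonneg _, fun u => ?_⟩
    have : e.symm (canon Y u) = u := e.symm_apply_apply u
    exact (congrArg norm this).symm.trans_le
      ((e.symm : HardyOne Y →L[ℂ] ProjTensor (HardyOne ℂ) Y).le_opNorm _)
  · rintro ⟨c, hc, h⟩ f
    have ha : AntilipschitzWith c.toNNReal (canon Y) :=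
      AddMonoidHomClass.antilipschitz_of_bound _ fun u => by
        rw [Real.coe_toNNReal c hc]
        exact h u
    exact hardy_induction (LinearMap.range (canon Y).toLinearMap)
      (ha.isClosed_range (canon Y).uniformContinuous)
      (fun k y => ⟨_, canon_tensor_expoH k y⟩) f

end FejerHardy

/-! ### Hahn–Banach and the dual of a finite sup-norm power -/

section HahnBanach

/-- The inequality makes `Φ` vanish on the kernel of `R`, so it descends to the range of `R` with
norm at most `M`, and Hahn–Banach extends it. -/
lemma exists_dual_factor {V Z : Type*} [AddCommGroup V] [Module ℂ V] [NormedAddCommGroup Z]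
    [NormedSpace ℂ Z] (R : V →ₗ[ℂ] Z) (Φ : V →ₗ[ℂ] ℂ) {M : ℝ} (hM : 0 ≤ M)
    (h : ∀ x, ‖Φ x‖ ≤ M * ‖R x‖) : ∃ Ψ : StrongDual ℂ Z, ‖Ψ‖ ≤ M ∧ ∀ x, Ψ (R x) = Φ x := by
  have hker : LinearMap.ker R ≤ LinearMap.ker Φ := fun x hx => by
    have := h x
    rw [LinearMap.mem_ker.1 hx, norm_zero, mul_zero] at this
    exact LinearMap.mem_ker.2 (norm_le_zero_iff.1 this)
  let f : LinearMap.range R →ₗ[ℂ] ℂ :=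
    ((LinearMap.ker R).liftQ Φ hker).comp R.quotKerEquivRange.symm.toLinearMap
  have hf : ∀ x, f ⟨R x, LinearMap.mem_range_self R x⟩ = Φ x := fun x => by
    simp only [f, LinearMap.comp_apply, LinearEquiv.coe_coe,
      LinearMap.quotKerEquivRange_symm_apply_image, Submodule.mkQ_apply, Submodule.liftQ_apply]
  let g : StrongDual ℂ (LinearMap.range R) := f.mkContinuous M <| by
    rintro ⟨_, x, rfl⟩
    rw [hf x]
    exact h x
  obtain ⟨Ψ, hΨ, hn⟩ := exists_extension_norm_eq (LinearMap.range R) g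
  refine ⟨Ψ, hn.trans_le (LinearMap.mkContinuous_norm_le _ hM _), fun x => ?_⟩
  exact (hΨ ⟨R x, LinearMap.mem_range_self R x⟩).trans (hf x)

variable {X : Type*} [NormedAddCommGroup X] [NormedSpace ℂ X]

lemma exists_almost_norming (y : StrongDual ℂ X) {ε : ℝ} (hε : 0 < ε) :
    ∃ x : X, ‖x‖ ≤ 1 ∧ ‖y‖ - ε ≤ (y x).re := by
  obtain ⟨x, hx, hy⟩ := y.exists_lt_apply_of_lt_opNorm (sub_lt_self ‖y‖ hε)
  obtain ⟨c, hc, hcx⟩ := Complex.exists_norm_eq_mul_self (y x)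
  refine ⟨c • x, ?_, ?_⟩
  · rw [norm_smul, hc, one_mul]
    exact hx.le
  · rw [map_smul, smul_eq_mul, ← hcx, Complex.ofReal_re]
    exact hy.le

/-- Almost norming unit-ball vectors, one per coordinate, assemble to a single vector of sup norm at
most 1, on which `Ψ` nearly equals the sum. -/
lemma sum_norm_comp_single_le {ι : Type*} [Fintype ι] [DecidableEq ι]
    (Ψ : StrongDual ℂ (ι → X)) :
    ∑ j, ‖Ψ.comp (ContinuousLinearMap.single ℂ (fun _ : ι => X) j)‖ ≤ ‖Ψ‖ := by
  refine le_of_forall_pos_le_add fun ε hε => ?_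
  -- The `+ 1` keeps the denominator positive when the index set is empty.
  have hε' : 0 < ε / (Fintype.card ι + 1) := by positivity
  choose x hx hy using fun j => exists_almost_norming
    (Ψ.comp (ContinuousLinearMap.single ℂ (fun _ : ι => X) j)) hε'
  have h1 : Ψ x = ∑ j, Ψ.comp (ContinuousLinearMap.single ℂ (fun _ : ι => X) j) (x j) := by
    conv_lhs => rw [← Finset.univ_sum_single x]
    rw [map_sum]
    rfl
  have h2 : (Ψ x).re ≤ ‖Ψ‖ := by
    refine (Complex.re_le_norm _).trans (Ψ.le_of_opNorm_le_of_le le_rfl ?_ |>.trans (mul_one _).le)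
    exact (pi_norm_le_iff_of_nonneg zero_le_one).2 hx
  have h3 := Finset.sum_le_sum fun j (_ : j ∈ Finset.univ) => hy j
  rw [Finset.sum_sub_distrib, Finset.sum_const, Finset.card_univ, nsmul_eq_mul,
    ← Complex.re_sum, ← h1] at h3
  have h4 : (Fintype.card ι : ℝ) * (ε / (Fintype.card ι + 1)) ≤ ε := by
    rw [mul_div_assoc', div_le_iff₀ (by positivity)]
    nlinarith
  linarith

end HahnBanach

/-! ### The functional on L¹(X*) induced by an operator L¹ → X -/

section Pairing

variable {X : Type*} [NormedAddCommGroup X] [NormedSpace ℂ X]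

/-- The set function `A ↦ (y ↦ y(w(1_A)))`. -/
def pairingSet (w : LOne ℂ →L[ℂ] X) (A : Set UnitAddCircle) : StrongDual ℂ X →L[ℝ] ℂ :=
  open Classical in
  if hA : MeasurableSet A then
    (NormedSpace.inclusionInDoubleDual ℂ X
      (w (indicatorConstLp 1 hA (measure_ne_top _ _) 1))).restrictScalars ℝ
  else 0

lemma pairingSet_apply (w : LOne ℂ →L[ℂ] X) {A : Set UnitAddCircle} (hA : MeasurableSet A)
    (y : StrongDual ℂ X) :
    pairingSet w A y = y (w (indicatorConstLp 1 hA (measure_ne_top _ _) 1)) := by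
  rw [pairingSet, dif_pos hA]
  rfl

/-- An operator on L¹ need not be given by an X-valued density, so the pairing is built by extending
a vector measure. This is the domination by `‖w‖` times Haar measure that the extension requires. -/
lemma dominated_pairingSet (w : LOne ℂ →L[ℂ] X) :
    DominatedFinMeasAdditive AddCircle.haarAddCircle (pairingSet w) ‖w‖ := by
  refine ⟨fun A B hA hB hA' hB' hd => ?_, fun A hA _ => ?_⟩
  · ext y
    rw [add_apply, pairingSet_apply w (hA.union hB), pairingSet_apply w hA, pairingSet_apply w hB,
      ← map_add, ← map_add]
    congr 2
    exact indicatorConstLp_disjoint_union hA hB hA' hB' hd 1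
  · refine ContinuousLinearMap.opNorm_le_bound _ (by positivity) fun y => ?_
    rw [pairingSet_apply w hA, mul_comm]
    refine y.le_of_opNorm_le_of_le le_rfl ((w.le_opNorm _).trans_eq ?_)
    rw [norm_indicatorConstLp one_ne_zero ENNReal.one_ne_top]
    simp

lemma tensorFun_indicatorConstLp {A : Set UnitAddCircle} (hA : MeasurableSet A) (c : ℂ) (x : X) :
    tensorFun (indicatorConstLp 1 hA (measure_ne_top AddCircle.haarAddCircle A) c) x
      = indicatorConstLp 1 hA (measure_ne_top _ _) (c • x) := by
  refine Lp.ext ?_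
  filter_upwards [coeFn_tensorFun
      (indicatorConstLp 1 hA (measure_ne_top AddCircle.haarAddCircle A) c) x,
    indicatorConstLp_coeFn (p := 1) (hs := hA)
      (hμs := measure_ne_top AddCircle.haarAddCircle A) (c := c),
    indicatorConstLp_coeFn (p := 1) (hs := hA)
      (hμs := measure_ne_top AddCircle.haarAddCircle A) (c := c • x)] with t h1 h2 h3
  rw [h1, h2, h3]
  by_cases ht : t ∈ A <;> simp [ht]

/-- An operator `w : L¹ → X` induces a functional on `L¹(𝕋; X*)` of norm at most `‖w‖`. -/
lemma exists_pairing (w : LOne ℂ →L[ℂ] X) :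
    ∃ Ψ : StrongDual ℂ (LOne (StrongDual ℂ X)), (∀ G, ‖Ψ G‖ ≤ ‖w‖ * ‖G‖) ∧
      ∀ f y, Ψ (tensorFun f y) = y (w f) := by
  have hT := dominated_pairingSet w
  have hs : ∀ c : ℂ, ∀ s y, pairingSet w s (c • y) = c • pairingSet w s y := by
    intro c s y
    -- Complex homogeneity, trivial for nonmeasurable sets by the default value 0, makes the
    -- real-linear construction complex-linear.
    by_cases hA : MeasurableSet s
    · rw [pairingSet_apply w hA, pairingSet_apply w hA]
      rfl
    · simp [pairingSet, hA]
  refine ⟨L1.setToL1' ℂ hT hs, fun G => ?_, fun f y => ?_⟩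
  · rw [← L1.setToL1_eq_setToL1']
    exact L1.norm_setToL1_le_mul_norm hT (norm_nonneg _) G
  · let S : LOne ℂ →L[ℂ] ℂ := (L1.setToL1' ℂ hT hs).comp
      ((ContinuousLinearMap.toSpanSingleton ℂ y).compLpL 1 AddCircle.haarAddCircle)
    change S f = (y.comp w) f
    induction f using Lp.induction ENNReal.one_ne_top with
    | @indicatorConst c A hA hμ =>
      have hc : indicatorConstLp 1 hA (measure_ne_top AddCircle.haarAddCircle A) c
          = c • indicatorConstLp 1 hA (measure_ne_top AddCircle.haarAddCircle A) (1 : ℂ) := by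
        refine Lp.ext ?_
        filter_upwards [Lp.coeFn_smul c
            (indicatorConstLp 1 hA (measure_ne_top AddCircle.haarAddCircle A) (1 : ℂ)),
          indicatorConstLp_coeFn (p := 1) (hs := hA)
            (hμs := measure_ne_top AddCircle.haarAddCircle A) (c := c),
          indicatorConstLp_coeFn (p := 1) (hs := hA)
            (hμs := measure_ne_top AddCircle.haarAddCircle A) (c := (1 : ℂ))] with t h1 h2 h3
        rw [h1, h2, Pi.smul_apply, h3]
        simp [Set.indicator]
      rw [Lp.simpleFunc.coe_indicatorConst]
      change L1.setToL1' ℂ hT hs (tensorFun (indicatorConstLp 1 hA _ c) y) = _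
      rw [tensorFun_indicatorConstLp hA, ← L1.setToL1_eq_setToL1',
        L1.setToL1_indicatorConstLp hT hA, hs, pairingSet_apply w hA, hc, map_smul]
      rfl
    | add hf hg _ h1 h2 => rw [map_add, map_add, h1, h2]
    | isClosed => exact isClosed_eq S.continuous (y.comp w).continuous

end Pairing

/-! ### From extensions to a lower bound for the canonical map -/

section ExtensionToBound

variable {X : Type*} [NormedAddCommGroup X] [NormedSpace ℂ X]

/-- The finitely-spectral operator `h ↦ ∑ m(n) ĥ(n) xₙ` on `H¹`, where `m` is the Fejér
multiplier. -/
def fejerOp (N : ℕ) (x : ℕ → X) : HardyOne ℂ →L[ℂ] X :=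
  ∑ n ∈ Finset.range N, fejerWeight N n •
    ((coeff ℂ n).comp (HardyOne ℂ).subtypeL).smulRight (x n)

lemma fejerOp_apply (N : ℕ) (x : ℕ → X) (f : HardyOne ℂ) :
    fejerOp N x f = ∑ n ∈ Finset.range N, (fejerWeight N n * coeff ℂ n f) • x n := by
  simp [fejerOp, smul_smul]

lemma fejerOp_expoH (N : ℕ) (x : ℕ → X) (k : ℕ) :
    fejerOp N x (expoH k) = fejerWeight N k • x k := by
  rw [fejerOp_apply]
  have h : ∀ n : ℕ, coeff ℂ n (expoH k : LOne ℂ) = if n = k then 1 else 0 := fun n => by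
    refine (coeff_expo n k).trans (if_congr Nat.cast_inj rfl rfl)
  simp only [h, mul_ite, mul_one, mul_zero, ite_smul, zero_smul, Finset.sum_ite_eq',
    Finset.mem_range]
  split_ifs with hk
  · rfl
  · rw [fejerWeight_eq_zero (fun h => hk (by exact_mod_cast h.2)), zero_smul]

lemma fejerOp_expoH_of_le {N k : ℕ} (x : ℕ → X) (h : N ≤ k) : fejerOp N x (expoH k) = 0 := by
  rw [fejerOp_expoH, fejerWeight_eq_zero (fun hk => by have := hk.2; omega), zero_smul]

lemma finSpecH_fejerOp (N : ℕ) (x : ℕ → X) : FinSpecH (fejerOp N x) :=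
  -- The bound `N + 1` is positive even for `N = 0`.
  ⟨N + 1, N.succ_pos, fun _ hn => fejerOp_expoH_of_le x (by omega)⟩

lemma norm_expoH_le (n : ℕ) : ‖expoH n‖ ≤ 1 := norm_expo_le n

/-- The sum is the value at `canon u` of the functional induced by an extension of `fejerOp N x`.
This is the only use of the extension property. -/
lemma norm_sum_fejerWeight_le [CompleteSpace X] {lam : ℝ} (hlam : IsExtensionConstant X lam)
    (u : ProjTensor (HardyOne ℂ) (StrongDual ℂ X)) (N : ℕ) (x : ℕ → X) :
    ‖∑ n ∈ Finset.range N, fejerWeight N n * coeffP (StrongDual ℂ X) n u (x n)‖ ≤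
      lam * ‖canon (StrongDual ℂ X) u‖ * ‖fejerOp N x‖ := by
  obtain ⟨w, -, hw, hwn⟩ := hlam.2 _ (finSpecH_fejerOp N x)
  obtain ⟨Ψ, hΨ, hΨt⟩ := exists_pairing w
  let S : StrongDual ℂ (ProjTensor (HardyOne ℂ) (StrongDual ℂ X)) :=
    ∑ n ∈ Finset.range N, fejerWeight N n •
      (NormedSpace.inclusionInDoubleDual ℂ X (x n)).comp (coeffP (StrongDual ℂ X) n)
  have hS : ∀ u, S u =
      ∑ n ∈ Finset.range N, fejerWeight N n * coeffP (StrongDual ℂ X) n u (x n) := fun u => by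
    simp [S]
  have hSΨ : S = Ψ.comp ((HardyOne (StrongDual ℂ X)).subtypeL.comp (canon (StrongDual ℂ X))) := by
    refine projTensor_ext fun k y => ?_
    change _ = Ψ (canon (StrongDual ℂ X) (tensor _ _ (expoH k) y) : LOne _)
    rw [canon_tensor_expoH, hS]
    change _ = Ψ (tensorFun (expo k) y)
    rw [hΨt, show w (expo k) = fejerOp N x (expoH k) from hw (expoH k), fejerOp_apply, map_sum]
    refine Finset.sum_congr rfl fun n _ => ?_
    rw [coeffP_tensor, map_smul, smul_apply, smul_eq_mul, smul_eq_mul, mul_assoc]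
  rw [← hS, hSΨ]
  refine (hΨ _).trans ?_
  calc ‖w‖ * ‖canon (StrongDual ℂ X) u‖
      ≤ lam * ‖fejerOp N x‖ * ‖canon (StrongDual ℂ X) u‖ :=
        mul_le_mul_of_nonneg_right hwn (norm_nonneg _)
    _ = _ := by ring

/-- Up to `ε`, the norm of `fejerOp N x` is attained on a finite set independent of `x`. -/
lemma exists_finite_norming (N : ℕ) {ε : ℝ} (hε : 0 < ε) :
    ∃ (m : ℕ) (h : Fin m → HardyOne ℂ), (∀ j, ‖h j‖ ≤ 1) ∧
      ∀ x : ℕ → X, ‖fejerOp N x‖ ≤ (1 + ε) * ‖fun j => fejerOp N x (h j)‖ := by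
  let a : HardyOne ℂ →L[ℂ] (Fin N → ℂ) := ContinuousLinearMap.pi fun n =>
    fejerWeight N (n : ℕ) • (coeff ℂ (n : ℕ)).comp (HardyOne ℂ).subtypeL
  have hax : ∀ (x : ℕ → X) f, fejerOp N x f = ∑ n : Fin N, a f n • x n := fun x f => by
    rw [fejerOp_apply, Finset.sum_range]
    rfl
  -- Since `fejerOp N x` maps `expoH n` to a nonzero multiple of `x n`, the sum of the `‖x n‖` is at
  -- most `C` times its norm. Then `δ` is chosen so that the approximation error can be absorbed.
  set C : ℝ := ∑ n : Fin N, ‖fejerWeight N (n : ℕ)‖⁻¹ with hC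
  have hC0 : 0 ≤ C := by positivity
  set δ : ℝ := ε / ((1 + ε) * (C + 1)) with hδ
  have hδ0 : 0 < δ := by positivity
  have hδC : (1 + ε) * (δ * C) ≤ ε := by
    rw [hδ, div_mul_eq_mul_div, mul_div_assoc', div_le_iff₀ (by positivity)]
    have : 0 ≤ (1 + ε) * ε := by positivity
    nlinarith
  -- `fejerOp N x` depends on f only through `a f`, which lies in a finite-dimensional space, so a
  -- finite `δ`-net of the image of the unit ball serves all x at once.
  have htb : TotallyBounded (a '' Metric.closedBall 0 1) :=
    (a.lipschitz.isBounded_image Metric.isBounded_closedBall).isCompact_closure.totallyBounded.subset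
      subset_closure
  obtain ⟨t, hts, htf, htc⟩ := Metric.finite_approx_of_totallyBounded htb δ hδ0
  have := htf.fintype
  choose g hg hga using hts
  let e := Fintype.equivFin t
  refine ⟨Fintype.card t, fun j => g (e.symm j).2, fun j => ?_, fun x => ?_⟩
  · simpa using hg (e.symm j).2
  set R : ℝ := ‖fun j => fejerOp N x (g (e.symm j).2)‖ with hR
  have hxn : ∀ n : Fin N, ‖x n‖ ≤ ‖fejerWeight N (n : ℕ)‖⁻¹ * ‖fejerOp N x‖ := fun n => by
    have h0 : 0 < ‖fejerWeight N (n : ℕ)‖ := norm_pos_iff.2 (fejerWeight_ne_zero n.2)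
    have h1 := (fejerOp N x).le_of_opNorm_le_of_le le_rfl (norm_expoH_le n)
    rw [fejerOp_expoH, norm_smul, mul_one] at h1
    rw [inv_mul_eq_div, le_div_iff₀' h0]
    exact h1
  have hsum : ∑ n : Fin N, ‖x n‖ ≤ C * ‖fejerOp N x‖ := by
    rw [hC, Finset.sum_mul]
    exact Finset.sum_le_sum fun n _ => hxn n
  have hball : ∀ f : HardyOne ℂ, ‖f‖ ≤ 1 → ‖fejerOp N x f‖ ≤ R + δ * (C * ‖fejerOp N x‖) := by
    intro f hf
    have hfa : a f ∈ a '' Metric.closedBall 0 1 := ⟨f, by simpa using hf, rfl⟩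
    obtain ⟨b, hb, hfb⟩ := Set.mem_iUnion₂.1 (htc hfa)
    have h1 : ‖fejerOp N x (g hb)‖ ≤ R := by
      have := norm_le_pi_norm (fun j => fejerOp N x (g (e.symm j).2)) (e ⟨b, hb⟩)
      simpa using this
    have h2 : ‖fejerOp N x f - fejerOp N x (g hb)‖ ≤ δ * (C * ‖fejerOp N x‖) := by
      rw [hax, hax, ← Finset.sum_sub_distrib, hga hb]
      refine (norm_sum_le _ _).trans ((Finset.sum_le_sum fun n _ => ?_).trans
        ((Finset.mul_sum _ _ _).symm.trans_le (mul_le_mul_of_nonneg_left hsum hδ0.le)))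
      rw [← sub_smul, norm_smul]
      refine mul_le_mul_of_nonneg_right ?_ (norm_nonneg _)
      have := (norm_le_pi_norm (a f - b) n).trans (mem_ball_iff_norm.1 hfb).le
      exact this
    calc ‖fejerOp N x f‖ = ‖fejerOp N x (g hb) + (fejerOp N x f - fejerOp N x (g hb))‖ := by
          rw [add_sub_cancel]
      _ ≤ _ := (norm_add_le _ _).trans (add_le_add h1 h2)
  have hop : ‖fejerOp N x‖ ≤ R + δ * (C * ‖fejerOp N x‖) := by
    refine ContinuousLinearMap.opNorm_le_of_unit_norm (by positivity) fun f hf => ?_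
    exact hball f hf.le
  have h3 : (1 + ε) * (δ * C) * ‖fejerOp N x‖ ≤ ε * ‖fejerOp N x‖ :=
    mul_le_mul_of_nonneg_right hδC (fejerOp N x).opNorm_nonneg
  -- Multiplying `hop` by `1 + ε` and subtracting `ε * ‖fejerOp N x‖` by `h3` leaves the claim.
  nlinarith

/-- By duality: the functional given by the coefficients of u factors through evaluation at the
finitely many norming points, and the factor is a finite family in X* that represents the Fejér mean
by elementary tensors. -/
lemma norm_fejerP_le [CompleteSpace X] {lam : ℝ} (hlam : IsExtensionConstant X lam)
    (u : ProjTensor (HardyOne ℂ) (StrongDual ℂ X)) (N : ℕ) :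
    ‖fejerP (StrongDual ℂ X) N u‖ ≤ lam * ‖canon (StrongDual ℂ X) u‖ := by
  set M : ℝ := lam * ‖canon (StrongDual ℂ X) u‖ with hM
  have hM0 : 0 ≤ M := mul_nonneg hlam.1 (norm_nonneg _)
  suffices H : ∀ ε : ℝ, 0 < ε → ‖fejerP (StrongDual ℂ X) N u‖ ≤ M * (1 + ε) by
    refine le_of_forall_pos_le_add fun ε hε => (H (ε / (M + 1)) (by positivity)).trans ?_
    rw [mul_add, mul_one, add_le_add_iff_left, mul_div_assoc', div_le_iff₀ (by positivity)]
    nlinarith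
  intro ε hε
  obtain ⟨m, h, hh, hx⟩ := exists_finite_norming (X := X) N hε
  let R : (ℕ → X) →ₗ[ℂ] (Fin m → X) :=
    { toFun := fun x j => fejerOp N x (h j)
      map_add' := fun x y => by
        ext j
        simp [fejerOp_apply, Finset.sum_add_distrib]
      map_smul' := fun c x => by
        ext j
        simp [fejerOp_apply, Finset.smul_sum, smul_comm c] }
  let Φ : (ℕ → X) →ₗ[ℂ] ℂ :=
    { toFun := fun x =>
        ∑ n ∈ Finset.range N, fejerWeight N n * coeffP (StrongDual ℂ X) n u (x n)
      map_add' := fun x y => by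
        simp [mul_add, Finset.sum_add_distrib]
      map_smul' := fun c x => by
        simp [Finset.mul_sum, mul_left_comm c] }
  obtain ⟨Ψ, hΨn, hΨ⟩ := exists_dual_factor R Φ (M := M * (1 + ε)) (by positivity) fun x =>
    (norm_sum_fejerWeight_le hlam u N x).trans <| by
      rw [mul_assoc M]
      exact mul_le_mul_of_nonneg_left (hx x) hM0
  set ξ : Fin m → StrongDual ℂ X := fun j =>
    Ψ.comp (ContinuousLinearMap.single ℂ (fun _ : Fin m => X) j) with hξ
  have hΨξ : ∀ z : Fin m → X, Ψ z = ∑ j, ξ j (z j) := fun z => by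
    conv_lhs => rw [← Finset.univ_sum_single z]
    rw [map_sum]
    rfl
  have hcoef : ∀ n ∈ Finset.range N, fejerWeight N n • coeffP (StrongDual ℂ X) n u
      = ∑ j, (fejerWeight N n * coeff ℂ n (h j : LOne ℂ)) • ξ j := by
    intro n hn
    -- Testing on the sequence with the single entry `z` at place `n` isolates the n-th coefficient.
    ext z
    have h1 := hΨ (Pi.single n z)
    rw [hΨξ] at h1
    have h2 : Φ (Pi.single n z) = fejerWeight N n * coeffP (StrongDual ℂ X) n u z := by
      refine (Finset.sum_eq_single_of_mem n hn fun k _ hk => ?_).trans ?_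
      · rw [Pi.single_eq_of_ne hk, map_zero, mul_zero]
      · rw [Pi.single_eq_same]
    have h3 : ∀ j, R (Pi.single n z) j = (fejerWeight N n * coeff ℂ n (h j : LOne ℂ)) • z := by
      intro j
      refine (fejerOp_apply _ _ _).trans
        ((Finset.sum_eq_single_of_mem n hn fun k _ hk => ?_).trans ?_)
      · rw [Pi.single_eq_of_ne hk, smul_zero]
      · rw [Pi.single_eq_same]
    rw [smul_apply, smul_eq_mul, ← h2, ← h1, sum_apply]
    refine Finset.sum_congr rfl fun j _ => ?_
    rw [h3, map_smul, smul_apply]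
  have hsum : fejerP (StrongDual ℂ X) N u
      = ∑ j, tensor (HardyOne ℂ) (StrongDual ℂ X) (fejerH N (h j)) (ξ j) := by
    rw [fejerP_apply]
    simp only [fejerH_apply, map_sum, sum_apply]
    rw [Finset.sum_comm]
    refine Finset.sum_congr rfl fun n hn => ?_
    rw [← map_smul, hcoef n hn, map_sum]
    refine Finset.sum_congr rfl fun j _ => ?_
    rw [map_smul, map_smul, smul_apply]
  rw [hsum]
  refine (norm_sum_le _ _).trans (le_trans ?_ ((sum_norm_comp_single_le Ψ).trans hΨn))
  refine Finset.sum_le_sum fun j _ => (norm_tensor_le _ _).trans ?_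
  exact mul_le_of_le_one_left (norm_nonneg _) ((norm_fejerH_apply_le N _).trans (hh j))

/-- An extension constant bounds the inverse of the canonical map. -/
lemma IsExtensionConstant.norm_le [CompleteSpace X] {lam : ℝ} (hlam : IsExtensionConstant X lam)
    (u : ProjTensor (HardyOne ℂ) (StrongDual ℂ X)) :
    ‖u‖ ≤ lam * ‖canon (StrongDual ℂ X) u‖ :=
  le_of_tendsto (tendsto_fejerP u).norm
    (Filter.Eventually.of_forall fun N => norm_fejerP_le hlam u N)

end ExtensionToBound

/-! ### Simple functions norm L¹(X*) -/

section SimplePairing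

variable {X : Type*} [NormedAddCommGroup X] [NormedSpace ℂ X]

/-- The operator `f ↦ ∫ f g` on `L¹`, for a simple function `g` bounded by one. -/
def simpleOp (g : SimpleFunc UnitAddCircle X) (hg : ∀ t, ‖g t‖ ≤ 1) : LOne ℂ →L[ℂ] X :=
  integralOp (fun t => ContinuousLinearMap.toSpanSingleton ℂ (g t))
    ((g.map fun x => ContinuousLinearMap.toSpanSingleton ℂ x).aestronglyMeasurable) 1 fun t => by
      rw [ContinuousLinearMap.norm_toSpanSingleton]
      exact hg t

/-- The functional `F ↦ ∫ ⟨F, g⟩` on `L¹(𝕋; X*)`, for a simple function `g` bounded by one. -/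
def simplePairing (g : SimpleFunc UnitAddCircle X) (hg : ∀ t, ‖g t‖ ≤ 1) :
    StrongDual ℂ (LOne (StrongDual ℂ X)) :=
  integralOp (fun t => NormedSpace.inclusionInDoubleDual ℂ X (g t))
    ((g.map fun x => NormedSpace.inclusionInDoubleDual ℂ X x).aestronglyMeasurable) 1 fun t =>
      (NormedSpace.double_dual_bound ℂ X (g t)).trans (hg t)

lemma norm_simpleOp_le (g : SimpleFunc UnitAddCircle X) (hg : ∀ t, ‖g t‖ ≤ 1) :
    ‖simpleOp g hg‖ ≤ 1 :=
  norm_integralOp_le _ _ _ zero_le_one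

lemma norm_simplePairing_le (g : SimpleFunc UnitAddCircle X) (hg : ∀ t, ‖g t‖ ≤ 1) :
    ‖simplePairing g hg‖ ≤ 1 :=
  norm_integralOp_le _ _ _ zero_le_one

lemma simplePairing_tensorFun [CompleteSpace X] (g : SimpleFunc UnitAddCircle X)
    (hg : ∀ t, ‖g t‖ ≤ 1) (f : LOne ℂ) (y : StrongDual ℂ X) :
    simplePairing g hg (tensorFun f y) = y (simpleOp g hg f) := by
  change ∫ t, NormedSpace.inclusionInDoubleDual ℂ X (g t) (tensorFun f y t)
      ∂AddCircle.haarAddCircle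
    = y (∫ t, ContinuousLinearMap.toSpanSingleton ℂ (g t) (f t) ∂AddCircle.haarAddCircle)
  rw [← ContinuousLinearMap.integral_comp_comm]
  · refine integral_congr_ae ?_
    filter_upwards [coeFn_tensorFun f y] with t ht
    rw [ht, NormedSpace.dual_def, ContinuousLinearMap.toSpanSingleton_apply, map_smul]
    rfl
  · exact integrable_apply ((g.map fun x =>
      ContinuousLinearMap.toSpanSingleton ℂ x).aestronglyMeasurable) (C := 1) (fun t =>
        (ContinuousLinearMap.norm_toSpanSingleton (g t)).trans_le (hg t)) f

/-- The `X`-valued simple functions bounded by one norm `L¹(𝕋; X*)`. -/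
lemma norm_le_of_simplePairing_le (F : LOne (StrongDual ℂ X)) {M : ℝ}
    (h : ∀ (g : SimpleFunc UnitAddCircle X) (hg : ∀ t, ‖g t‖ ≤ 1), ‖simplePairing g hg F‖ ≤ M) :
    ‖F‖ ≤ M := by
  refine le_of_forall_pos_le_add fun ε hε => ?_
  have hε3 : 0 < ε / 3 := by positivity
  obtain ⟨s, hs⟩ := Metric.denseRange_iff.1
    (Lp.simpleFunc.denseRange (E := StrongDual ℂ X) (μ := AddCircle.haarAddCircle)
      ENNReal.one_ne_top) F (ε / 3) hε3
  rw [dist_eq_norm] at hs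
  -- Composing the simple approximant `s` with a choice of almost norming vectors gives a simple
  -- `g`. Haar measure has total mass 1, so the pointwise loss `ε / 3` stays `ε / 3` after
  -- integration.
  choose χ hχ1 hχ2 using fun y : StrongDual ℂ X => exists_almost_norming y hε3
  let g : SimpleFunc UnitAddCircle X := (Lp.simpleFunc.toSimpleFunc s).map χ
  have hg : ∀ t, ‖g t‖ ≤ 1 := fun t => hχ1 _
  have h1 : ‖(s : LOne (StrongDual ℂ X))‖ - ε / 3 ≤ ‖simplePairing g hg s‖ := by
    refine le_trans ?_ (Complex.re_le_norm _)
    have hi : Integrable (fun t => NormedSpace.inclusionInDoubleDual ℂ X (g t)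
        ((s : LOne (StrongDual ℂ X)) t)) AddCircle.haarAddCircle :=
      integrable_apply ((g.map fun x =>
        NormedSpace.inclusionInDoubleDual ℂ X x).aestronglyMeasurable) (C := 1) (fun t =>
          (NormedSpace.double_dual_bound ℂ X (g t)).trans (hg t)) _
    have hre := integral_re hi
    have hre' : (simplePairing g hg s).re = ∫ t, (NormedSpace.inclusionInDoubleDual ℂ X (g t)
        ((s : LOne (StrongDual ℂ X)) t)).re ∂AddCircle.haarAddCircle := hre.symm
    have hc : ‖(s : LOne (StrongDual ℂ X))‖ - ε / 3
        = ∫ t, (‖(s : LOne (StrongDual ℂ X)) t‖ - ε / 3) ∂AddCircle.haarAddCircle := by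
      rw [integral_sub (lOne_integrable _).norm (integrable_const _), L1.norm_eq_integral_norm]
      simp
    rw [hre', hc]
    refine integral_mono_ae ((lOne_integrable _).norm.sub (integrable_const _)) hi.re ?_
    filter_upwards [Lp.simpleFunc.toSimpleFunc_eq_toFun s] with t ht
    change _ ≤ ((s : LOne (StrongDual ℂ X)) t (χ (Lp.simpleFunc.toSimpleFunc s t))).re
    rw [ht]
    exact hχ2 _
  have h2 : ‖simplePairing g hg s‖ ≤ M + ε / 3 := by
    have h3 : ‖simplePairing g hg (F - s)‖ ≤ ε / 3 :=
      ((simplePairing g hg).le_of_opNorm_le (norm_simplePairing_le g hg) _).trans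
        ((one_mul _).trans_le hs.le)
    rw [map_sub] at h3
    have h4 := norm_sub_norm_le (simplePairing g hg s) (simplePairing g hg F)
    rw [norm_sub_rev] at h4
    linarith [h g hg]
  have h5 := norm_sub_norm_le F (s : LOne (StrongDual ℂ X))
  linarith

end SimplePairing

/-! ### Finitely-spectral operators and corrected Fejér means -/

section Spectrum

variable {X : Type*} [NormedAddCommGroup X] [NormedSpace ℂ X]

lemma FinSpecL.add {u w : LOne ℂ →L[ℂ] X} (hu : FinSpecL u) (hw : FinSpecL w) :
    FinSpecL (u + w) := by
  obtain ⟨k, hk, hu⟩ := hu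
  obtain ⟨l, -, hw⟩ := hw
  refine ⟨max k l, lt_max_of_lt_left hk, fun n hn => ?_⟩
  rw [add_apply, hu n fun h => hn ⟨?_, ?_⟩, hw n fun h => hn ⟨?_, ?_⟩, add_zero] <;>
  · have h1 := h.1
    have h2 := h.2
    push_cast
    omega

variable (X) in
/-- The finitely-spectral operators on `L¹` that vanish on `H¹`. -/
def negSpec : Submodule ℂ (LOne ℂ →L[ℂ] X) where
  carrier := {u | FinSpecL u ∧ ∀ n : ℕ, u (expo n) = 0}
  zero_mem' := ⟨⟨1, one_pos, fun _ _ => rfl⟩, fun _ => rfl⟩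
  add_mem' := fun {u w} hu hw => ⟨hu.1.add hw.1, fun n => by
    rw [add_apply, hu.2, hw.2, add_zero]⟩
  smul_mem' := fun c u hu => ⟨by
    obtain ⟨k, hk, h⟩ := hu.1
    exact ⟨k, hk, fun n hn => by rw [smul_apply, h n hn, smul_zero]⟩, fun n => by
    rw [smul_apply, hu.2, smul_zero]⟩

/-- The operator `f ↦ ∑_{n < K} f̂(n) xₙ` on `L¹`. -/
def sumOp (K : ℕ) (x : ℕ → X) : LOne ℂ →L[ℂ] X :=
  ∑ n ∈ Finset.range K, (coeff ℂ n).smulRight (x n)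

lemma sumOp_apply (K : ℕ) (x : ℕ → X) (f : LOne ℂ) :
    sumOp K x f = ∑ n ∈ Finset.range K, coeff ℂ n f • x n := by
  simp [sumOp]

lemma sumOp_expo (K : ℕ) (x : ℕ → X) (k : ℕ) :
    sumOp K x (expo k) = if k < K then x k else 0 := by
  simp [sumOp_apply, coeff_expo]

lemma sumOp_expo_of_neg (K : ℕ) (x : ℕ → X) {k : ℤ} (hk : k < 0) : sumOp K x (expo k) = 0 := by
  rw [sumOp_apply]
  refine Finset.sum_eq_zero fun n _ => ?_
  rw [coeff_expo, if_neg (by omega), zero_smul]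

lemma sumOp_expo_of_notMem (K : ℕ) (x : ℕ → X) {k : ℤ} (hk : k ∉ Set.Icc (-(K : ℤ)) K) :
    sumOp K x (expo k) = 0 := by
  rcases lt_or_ge k 0 with h | h
  · exact sumOp_expo_of_neg K x h
  · lift k to ℕ using h
    rw [sumOp_expo, if_neg fun h => hk ⟨by omega, by omega⟩]

lemma finSpecL_sumOp (K : ℕ) (x : ℕ → X) : FinSpecL (sumOp K x) :=
  ⟨K + 1, K.succ_pos, fun n hn => sumOp_expo_of_notMem K x fun h => hn
    ⟨by have := h.1; push_cast; omega, by have := h.2; push_cast; omega⟩⟩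

/-- The multiplier of `correctedFejer`. -/
def correctedWeight (K N n : ℕ) : ℂ := if n < K then 1 else fejerWeight N n

/-- The Fejér mean of order `N`, corrected to fix `e^{inθ}` for `0 ≤ n < K`. -/
def correctedFejer (K N : ℕ) : LOne ℂ →L[ℂ] LOne ℂ :=
  fejer N + sumOp K fun n => (1 - fejerWeight N n) • expo n

lemma correctedFejer_expo (K N n : ℕ) :
    correctedFejer K N (expo n) = correctedWeight K N n • expo n := by
  rw [correctedFejer, add_apply, fejer_expo, sumOp_expo, correctedWeight]
  split_ifs
  · rw [← add_smul, add_sub_cancel]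
  · rw [add_zero]

lemma correctedFejer_expo_of_notMem {K N : ℕ} (hKN : K ≤ N) {k : ℤ}
    (hk : k ∉ Set.Icc (-(N : ℤ)) N) : correctedFejer K N (expo k) = 0 := by
  rw [correctedFejer, add_apply, fejer_expo, fejerWeight_eq_zero fun h => hk ⟨h.1.le, h.2.le⟩,
    sumOp_expo_of_notMem, zero_smul, add_zero]
  exact fun h => hk ⟨by have := h.1; omega, by have := h.2; omega⟩

lemma correctedWeight_eq_zero {K N n : ℕ} (hKN : K ≤ N) (h : N ≤ n) :
    correctedWeight K N n = 0 := by
  rw [correctedWeight, if_neg (by omega), fejerWeight_eq_zero fun hn => by have := hn.2; omega]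

lemma norm_correctedFejer_le (K N : ℕ) :
    ‖correctedFejer K N‖ ≤ 1 + ∑ n ∈ Finset.range K, ‖1 - fejerWeight N n‖ := by
  refine (norm_add_le _ _).trans (add_le_add (norm_fejer_le N) ((norm_sum_le _ _).trans
    (Finset.sum_le_sum fun n _ => ?_)))
  rw [ContinuousLinearMap.norm_smulRight_apply, norm_smul]
  calc ‖coeff ℂ n‖ * (‖1 - fejerWeight N n‖ * ‖expo n‖)
      ≤ 1 * (‖1 - fejerWeight N n‖ * 1) := by
        gcongr
        · exact norm_coeff_le _
        · exact norm_expo_le _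
    _ = _ := by ring

/-- For fixed `K` the correction is asymptotically free, so the constant c survives the passage to
the limit in N. -/
lemma tendsto_norm_correctedFejer_bound (K : ℕ) :
    Filter.Tendsto (fun N => 1 + ∑ n ∈ Finset.range K, ‖1 - fejerWeight N n‖) Filter.atTop
      (nhds 1) := by
  have h : Filter.Tendsto (fun N => ∑ n ∈ Finset.range K, ‖1 - fejerWeight N n‖) Filter.atTop
      (nhds (∑ n ∈ Finset.range K, ‖(1 : ℂ) - 1‖)) :=
    tendsto_finsetSum _ fun n _ => (tendsto_const_nhds.sub (tendsto_fejerWeight n)).norm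
  simpa using tendsto_const_nhds.add h

/-- Modulo operators vanishing on H¹, only the nonnegative frequencies of the composition count, and
these form a finite sum. -/
lemma comp_correctedFejer_sub_mem_negSpec {K N : ℕ} (hKN : K ≤ N) (w : LOne ℂ →L[ℂ] X) :
    w.comp (correctedFejer K N) - sumOp N (fun n => correctedWeight K N n • w (expo n))
      ∈ negSpec X := by
  refine ⟨⟨N + 1, N.succ_pos, fun k hk => ?_⟩, fun n => ?_⟩
  · have hk' : k ∉ Set.Icc (-(N : ℤ)) N := fun h => hk
      ⟨by have := h.1; push_cast; omega, by have := h.2; push_cast; omega⟩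
    rw [sub_apply, ContinuousLinearMap.comp_apply, correctedFejer_expo_of_notMem hKN hk',
      sumOp_expo_of_notMem _ _ hk', map_zero, sub_zero]
  · rw [sub_apply, ContinuousLinearMap.comp_apply, correctedFejer_expo, sumOp_expo, map_smul]
    split_ifs with h
    · exact sub_self _
    · rw [correctedWeight_eq_zero hKN (not_lt.1 h), zero_smul, sub_zero]

end Spectrum

/-! ### From a lower bound for the canonical map to extensions -/

section BoundToExtension

variable {X : Type*} [NormedAddCommGroup X] [NormedSpace ℂ X]

/-- A finitely-spectral operator `v : H¹ → X` acts on the projective tensor product of `H¹` with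
`X*`, with norm at most `‖v‖`. -/
lemma exists_dual_projTensor [CompleteSpace X] {v : HardyOne ℂ →L[ℂ] X} {K : ℕ}
    (hv : ∀ n, K ≤ n → v (expoH n) = 0) :
    ∃ T : StrongDual ℂ (ProjTensor (HardyOne ℂ) (StrongDual ℂ X)),
      (∀ f y, T (tensor _ _ f y) = y (v f)) ∧ ∀ u, ‖T u‖ ≤ ‖v‖ * ‖u‖ := by
  let T : StrongDual ℂ (ProjTensor (HardyOne ℂ) (StrongDual ℂ X)) :=
    ∑ n ∈ Finset.range K, (NormedSpace.inclusionInDoubleDual ℂ X (v (expoH n))).comp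
      (coeffP (StrongDual ℂ X) n)
  have hvs : v = (sumOp K fun n => v (expoH n)).comp (HardyOne ℂ).subtypeL := by
    refine hardy_scalar_ext fun k => ?_
    change _ = sumOp K (fun n => v (expoH n)) (expo k)
    rw [sumOp_expo]
    split_ifs with h
    · rfl
    · exact hv k (not_lt.1 h)
  have hT : ∀ f y, T (tensor _ _ f y) = y (v f) := fun f y => by
    conv_rhs => rw [hvs]
    change _ = y (sumOp K (fun n => v (expoH n)) (f : LOne ℂ))
    rw [sumOp_apply, map_sum]
    simp only [T, sum_apply, ContinuousLinearMap.comp_apply, coeffP_tensor, map_smul,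
      NormedSpace.dual_def]
  refine ⟨T, hT, projTensor_norm_le T v.opNorm_nonneg fun f y => ?_⟩
  rw [hT, ← mul_assoc, mul_comm]
  exact y.le_of_opNorm_le_of_le le_rfl (v.le_opNorm f)

/-- The distance from `sumOp K (v e₀, v e₁, …)` to the operators vanishing on `H¹`. -/
lemma norm_mk_sumOp_le [CompleteSpace X] {c : ℝ} (hc : 0 ≤ c)
    (h : ∀ u : ProjTensor (HardyOne ℂ) (StrongDual ℂ X), ‖u‖ ≤ c * ‖canon (StrongDual ℂ X) u‖)
    {v : HardyOne ℂ →L[ℂ] X} {K : ℕ} (hv : ∀ n, K ≤ n → v (expoH n) = 0) :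
    ‖(negSpec X).mkQ (sumOp K fun n => v (expoH n))‖ ≤ c * ‖v‖ := by
  -- `negSpec` need not be closed, so the quotient carries a seminorm; a norming functional of norm
  -- at most 1 exists all the same.
  obtain ⟨ψ, hψ1, hψ⟩ := exists_dual_vector'' ℂ ((negSpec X).mkQ (sumOp K fun n => v (expoH n)))
  let ψ' : StrongDual ℂ (LOne ℂ →L[ℂ] X) :=
    (ψ.toLinearMap ∘ₗ (negSpec X).mkQ).mkContinuous 1 fun u =>
      ψ.le_of_opNorm_le_of_le hψ1 (Submodule.Quotient.norm_mk_le _ u)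
  have hψ' : ∀ u, ψ' u = ψ ((negSpec X).mkQ u) := fun u => rfl
  have hψ'n : ‖ψ'‖ ≤ 1 := LinearMap.mkContinuous_norm_le _ zero_le_one _
  have hker : ∀ u w, u - w ∈ negSpec X → ψ' u = ψ' w := fun u w huw => by
    rw [hψ', hψ', Submodule.mkQ_apply, Submodule.mkQ_apply, (Submodule.Quotient.eq _).2 huw]
  -- These are the Fourier coefficients of the formal X*-valued series that represents `ψ'`, which
  -- annihilates `negSpec`.
  let y : ℕ → StrongDual ℂ X := fun n =>
    ψ'.comp (ContinuousLinearMap.smulRightL ℂ (LOne ℂ) X (coeff ℂ n))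
  have hy : ∀ M (x : ℕ → X), ψ' (sumOp M x) = ∑ n ∈ Finset.range M, y n (x n) := fun M x => by
    rw [sumOp, map_sum]
    rfl
  obtain ⟨T, hT, hTn⟩ := exists_dual_projTensor hv
  have key : ∀ N, K ≤ N → ‖(negSpec X).mkQ (sumOp K fun n => v (expoH n))‖ ≤
      ‖v‖ * (c * (1 + ∑ n ∈ Finset.range K, ‖1 - fejerWeight N n‖)) := by
    intro N hKN
    let u : ProjTensor (HardyOne ℂ) (StrongDual ℂ X) :=
      ∑ n ∈ Finset.range N, correctedWeight K N n • tensor _ _ (expoH n) (y n)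
    -- The corrected weights are exactly 1 below `K`, and v kills the frequencies from `K` on, so no
    -- error enters here.
    have hTu : T u = ψ' (sumOp K fun n => v (expoH n)) := by
      rw [hy, map_sum]
      simp only [map_smul, hT]
      rw [← Finset.sum_subset (Finset.range_subset_range.2 hKN)]
      · refine Finset.sum_congr rfl fun n hn => ?_
        rw [correctedWeight, if_pos (Finset.mem_range.1 hn), one_smul]
      · intro n _ hn
        rw [hv n (by simpa using hn), map_zero, smul_zero]
    -- Pairing the polynomial with a simple `g` amounts to applying `ψ'` to `simpleOp g` composed
    -- with the corrected Fejér mean, whose norm is at most that of the Fejér factor.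
    have hcu : ‖canon (StrongDual ℂ X) u‖ ≤
        1 + ∑ n ∈ Finset.range K, ‖1 - fejerWeight N n‖ := by
      change ‖(canon (StrongDual ℂ X) u : LOne (StrongDual ℂ X))‖ ≤ _
      refine norm_le_of_simplePairing_le _ fun g hg => ?_
      have : simplePairing g hg (canon (StrongDual ℂ X) u : LOne (StrongDual ℂ X))
          = ψ' ((simpleOp g hg).comp (correctedFejer K N)) := by
        rw [hker _ _ (comp_correctedFejer_sub_mem_negSpec hKN (simpleOp g hg)), hy]
        change ((simplePairing g hg).comp ((HardyOne (StrongDual ℂ X)).subtypeL.comp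
          (canon (StrongDual ℂ X)))) u = _
        rw [map_sum]
        refine Finset.sum_congr rfl fun n _ => ?_
        rw [map_smul, map_smul]
        congr 1
        change simplePairing g hg (canon (StrongDual ℂ X) (tensor _ _ (expoH n) (y n)) : LOne _) = _
        rw [canon_tensor_expoH]
        exact simplePairing_tensorFun g hg (expo n) (y n)
      rw [this]
      refine (ψ'.le_of_opNorm_le hψ'n _).trans ((one_mul _).trans_le ?_)
      refine (ContinuousLinearMap.opNorm_comp_le _ _).trans ?_
      refine (mul_le_of_le_one_left (ContinuousLinearMap.opNorm_nonneg _)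
        (norm_simpleOp_le g hg)).trans ?_
      exact norm_correctedFejer_le K N
    calc ‖(negSpec X).mkQ (sumOp K fun n => v (expoH n))‖ = ‖T u‖ := by
          rw [hTu, hψ', hψ]
          simp
      _ ≤ ‖v‖ * ‖u‖ := hTn u
      _ ≤ _ := mul_le_mul_of_nonneg_left
          ((h u).trans (mul_le_mul_of_nonneg_left hcu hc)) v.opNorm_nonneg
  have hlim := ((tendsto_norm_correctedFejer_bound K).const_mul c).const_mul ‖v‖
  rw [mul_one, mul_comm] at hlim
  exact ge_of_tendsto hlim (Filter.eventually_atTop.2 ⟨K, key⟩)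

/-- A bound for the inverse of the canonical map gives extension constants. -/
lemma isExtensionConstant_of_lt [CompleteSpace X] {c lam : ℝ} (hc : 0 ≤ c)
    (h : ∀ u : ProjTensor (HardyOne ℂ) (StrongDual ℂ X), ‖u‖ ≤ c * ‖canon (StrongDual ℂ X) u‖)
    (hlam : c < lam) : IsExtensionConstant X lam := by
  refine ⟨hc.trans hlam.le, fun v hv => ?_⟩
  -- For `v = 0` there is no room `(lam - c) * ‖v‖` in which to choose a representative below.
  rcases eq_or_ne v 0 with rfl | hv0
  · exact ⟨0, ⟨1, one_pos, fun _ _ => rfl⟩, fun _ => rfl,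
      norm_zero.trans_le (mul_nonneg (hc.trans hlam.le) (ContinuousLinearMap.opNorm_nonneg _))⟩
  obtain ⟨k, -, hk⟩ := hv
  have hk' : ∀ n, k + 1 ≤ n → v (expoH n) = 0 := fun n hn => hk n hn
  have hvpos : 0 < ‖v‖ := (norm_pos_iff (a := v)).2 hv0
  -- The quotient seminorm need not be attained; a representative with excess less than `(lam - c) *
  -- ‖v‖` is the extension sought.
  obtain ⟨w, hw, hwn⟩ := Submodule.Quotient.norm_mk_lt
    ((negSpec X).mkQ (sumOp (k + 1) fun n => v (expoH n)))
    (mul_pos (sub_pos.2 hlam) hvpos)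
  have hmem : w - sumOp (k + 1) (fun n => v (expoH n)) ∈ negSpec X :=
    (Submodule.Quotient.eq _).1 hw
  refine ⟨w, ?_, fun f => ?_, ?_⟩
  · have := hmem.1.add (finSpecL_sumOp (k + 1) fun n => v (expoH n))
    rwa [sub_add_cancel] at this
  · have : w.comp (HardyOne ℂ).subtypeL = v := by
      refine hardy_scalar_ext fun n => ?_
      change w (expo n) = _
      have h1 := hmem.2 n
      rw [sub_apply, sub_eq_zero] at h1
      rw [h1, sumOp_expo]
      split_ifs with hn
      · rfl
      · exact (hk' n (not_lt.1 hn)).symm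
    exact DFunLike.congr_fun this f
  · have := norm_mk_sumOp_le hc h hk'
    linarith

end BoundToExtension

end HOne

end

theorem proposition2p5 (X : Type*) [NormedAddCommGroup X] [NormedSpace ℂ X] [CompleteSpace X] :
    (HOne.IsHOneProjective (StrongDual ℂ X) ↔ ∃ lam : ℝ, HOne.IsExtensionConstant X lam) ∧
      (HOne.IsHOneProjective (StrongDual ℂ X) →
        IsGLB {lam : ℝ | HOne.IsExtensionConstant X lam} (HOne.eta (StrongDual ℂ X))) := by
  rw [HOne.isHOneProjective_iff]
  refine ⟨⟨?_, ?_⟩, ?_⟩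
  · rintro ⟨c, hc, h⟩
    exact ⟨c + 1, HOne.isExtensionConstant_of_lt hc h (lt_add_one c)⟩
  · rintro ⟨lam, hlam⟩
    exact ⟨lam, hlam.1, hlam.norm_le⟩
  · rintro ⟨c₀, hc₀, h₀⟩
    refine ⟨fun lam hlam => ?_, fun b hb => ?_⟩
    · exact csInf_le ⟨0, fun c hc => hc.1⟩ ⟨hlam.1, hlam.norm_le⟩
    · refine le_csInf ⟨c₀, hc₀, h₀⟩ fun c hc => ?_
      -- A lower bound `b` lies below every `lam > c`, hence below `c`.
      exact le_of_forall_gt_imp_ge_of_dense fun lam hlam =>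
        hb (HOne.isExtensionConstant_of_lt hc.1 hc.2 hlam)
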